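/- Let $\ldots,W_{-1},W_0,W_1,\ldots$ be a stationary Markov chain on a probability space $(\Omega,\mathcal A,P)$ with Polish state space $\mathcal W$, transition function $Q$ and marginal distribution $\pi$, and suppose the chain is reversible: $\int_A Q(w;B)\,\pi\{dw\}=\int_B Q(w;A)\,\pi\{dw\}$ for all Borel sets $A,B\subseteq\mathcal W$. Write $Qf(w)=\int_{\mathcal W} f(z)\,Q(w;dz)$, and for $n\ge 1$ let $V_n=I+Q+\cdots+Q^{n-1}$ and $\bar V_n=(V_1+\cdots+V_n)/n$. Let $g\in L^2(\pi)$ with $\int g\,d\pi=0$, and put $$S_n=\sum_{k=1}^n g(W_k),\qquad \sigma_n=\sqrt{E(S_n^2)},\qquad D_{n,k}=\bar V_n g(W_k)-Q\bar V_n g(W_{k-1}).$$ Assume that $\sigma_n^2=n\,\ell(n)$ for all $n\ge1$, where $\ell$ is a slowly varying function (that is, $\ell$ is positive and measurable on some half-line $[X,\infty)$ and $\lim_{x\to\infty}\ell(cx)/\ell(x)=1$ for every $c>0$). Suppose that there is a $\lambda\ge 0$ for which $$\frac1{\sigma_n^2}\sum_{k=1}^n E\left(D_{n,k}^2\mid W_{k-1}\right)\to\lambda\quad\text{in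 probability as } n\to\infty,$$ and that, for every $\epsilon>0$, $$\frac1{\sigma_n^2}\sum_{k=1}^n E\left(D_{n,k}^2\mathbf 1_{\{|D_{n,k}|>\epsilon\sigma_n\}}\mid W_{k-1}\right)\to 0\quad\text{in probability as } n\to\infty.$$ Then the conditional distribution of $S_n/\sigma_n$ given $W_0$ converges in probability, as $n\to\infty$, to the normal distribution with mean $0$ and variance $\lambda$ (the point mass at $0$ if $\lambda=0$); convergence is in the space of probability measures on $\mathbb R$ with the topology of weak convergence. -/

import Mathlib

open MeasureTheory ProbabilityTheory Filter Topology
open scoped NNReal ENNReal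

noncomputable section

namespace RevChain

/-- A function `ℓ`, positive and measurable on some half-line `[X, ∞)`, varies slowly (at infinity)
if `ℓ (c x) / ℓ x → 1` as `x → ∞`, for every `c > 0`. -/
def IsSlowlyVarying (ℓ : ℝ → ℝ) : Prop :=
  (∃ X : ℝ, (∀ x, X ≤ x → 0 < ℓ x) ∧ Measurable (fun x : Set.Ici X => ℓ x)) ∧
    ∀ c : ℝ, 0 < c → Tendsto (fun x => ℓ (c * x) / ℓ x) atTop (𝓝 1)

section Chain

variable {Ω S : Type*} [MeasurableSpace Ω] [mS : MeasurableSpace S]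

/-- The `σ`-algebra generated by `…, W (n - 1), W n`. -/
abbrev past (W : ℤ → Ω → S) (n : ℤ) : MeasurableSpace Ω :=
  ⨆ k : Set.Iic n, mS.comap (W k)

/-- `(W n)`, indexed by the integers, is a Markov chain on `(Ω, P)` with transition function `Q` and
with marginal distribution `π` at every time. -/
structure IsStationaryChain (P : Measure Ω) (W : ℤ → Ω → S) (Q : Kernel S S) (π : Measure S) :
    Prop where
  measurable : ∀ n, Measurable (W n)
  map_eq : ∀ n, P.map (W n) = π
  markov : ∀ n, ∀ B : Set S, MeasurableSet B →
    P[(W (n + 1) ⁻¹' B).indicator (fun _ => (1 : ℝ)) | past W n]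
      =ᵐ[P] fun ω => (Q (W n ω)).real B

/-- The transition operator, `Q f (w) = ∫ f(z) Q(w; dz)`. -/
def transOp (Q : Kernel S S) (f : S → ℝ) : S → ℝ := fun w => ∫ z, f z ∂(Q w)

/-- `V_n g = g + Q g + ⋯ + Q^{n-1} g`. -/
def V (Q : Kernel S S) (g : S → ℝ) (n : ℕ) : S → ℝ :=
  fun w => ∑ k ∈ Finset.range n, ((transOp Q)^[k] g) w

/-- `V̄_n g = (V_1 g + ⋯ + V_n g) / n`. -/
def Vbar (Q : Kernel S S) (g : S → ℝ) (n : ℕ) : S → ℝ :=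
  fun w => (∑ j ∈ Finset.Icc 1 n, V Q g j w) / n

/-- `D_{n,k} = V̄_n g (W_k) - Q V̄_n g (W_{k-1})`. -/
def D (Q : Kernel S S) (g : S → ℝ) (W : ℤ → Ω → S) (n : ℕ) (k : ℤ) : Ω → ℝ :=
  fun ω => Vbar Q g n (W k ω) - transOp Q (Vbar Q g n) (W (k - 1) ω)

/-- `S_n = g (W_1) + ⋯ + g (W_n)`. -/
def partialSum (g : S → ℝ) (W : ℤ → Ω → S) (n : ℕ) : Ω → ℝ :=
  fun ω => ∑ k ∈ Finset.Icc 1 n, g (W (k : ℤ) ω)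

/-- `σ_n = √(E (S_n ^ 2))`. -/
def sigma (P : Measure Ω) (g : S → ℝ) (W : ℤ → Ω → S) (n : ℕ) : ℝ :=
  √(∫ ω, (partialSum g W n ω) ^ 2 ∂P)

/-- The conditional distribution of `Z` given `Y`, as a random element of the space of probability
measures on the line, the latter with the Lévy–Prokhorov metric (the metric of weak
convergence). -/
def condLaw (P : Measure Ω) [IsFiniteMeasure P] (Z : Ω → ℝ) (Y : Ω → S) (ω : Ω) :
    LevyProkhorov (ProbabilityMeasure ℝ) :=
  LevyProkhorov.ofMeasure ⟨condDistrib Z Y P (Y ω), inferInstance⟩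

/-- The conditional distribution of `Z n` given `Y` converges in probability to `G`. -/
def TendstoCondLaw (P : Measure Ω) [IsFiniteMeasure P] (Z : ℕ → Ω → ℝ) (Y : Ω → S)
    (G : ProbabilityMeasure ℝ) : Prop :=
  TendstoInMeasure P (fun n => condLaw P (Z n) Y) atTop (fun _ => LevyProkhorov.ofMeasure G)

end Chain

end RevChain

end

/-! Reversibility makes the transition operator `T` a symmetric contraction of `L²(π)`. Let `c k =
⟨g, T^k g⟩`, the covariance at lag `k`. The product `⟨V_n g, T V_n g⟩ = ∑ c (i + j + 1)`, over `i, j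
< n`, is also the covariance of two adjacent blocks of length `n`, so twice it equals `σ_{2n}² - 2
σ_n²` (`inner_powSum_map`). Since `V_n g - T V_n g = g - T^n g` is bounded in norm, `‖V_n g‖² ≤
σ_{2n}² - 2 σ_n² + 4 ‖g‖²` (`norm_powSum_sq_le`). Slow variation gives `σ_{2n}² / σ_n² → 2`, so
`‖V_n g‖ = o(σ_n)`; as `σ` is increasing up to a bounded error (`le_add_of_odd_mono`), even `max_{j
≤ n} ‖V_j g‖ = o(σ_n)` (`eventually_forall_le_mul_sq`).

The average `h = V̄_n g` nearly solves Poisson's equation: `h - T h = g - T V_n g / n`. Hence `S_n`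
differs from the martingale `∑ D_{n,k}` by two boundary terms and an average, at most `3 max_{j ≤ n}
‖V_j g‖` in `L²` (`norm_sum_sub_martingale_le`), which is negligible against `σ_n`.

The two remaining hypotheses are those of the martingale central limit theorem. It is proved in a
form conditional on the initial `σ`-algebra: `E[Y (exp(i t M_n) - exp(-t² v / 2))] → 0` uniformly
over initial `Y` with `|Y| ≤ 1` (`IsMartingaleDiff.eventually_norm_integral_le`). By duality this is
`L¹` convergence of conditional characteristic functions, and bounded second moments turn it into
convergence in probability of the conditional laws (`tendstoCondLaw_of_charFun`). -/

namespace RevChain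

/-! ### Variances and orbit sums of a symmetric contraction. -/

section Hilbert

/-- The variance `∑_{|k| < n} (n - |k|) c_{|k|}` of the `n`-th partial sum of a stationary sequence
with covariances `c`, as a sum of its increments. -/
def varSeq (c : ℕ → ℝ) (n : ℕ) : ℝ :=
  ∑ j ∈ Finset.range n, (2 * ∑ i ∈ Finset.range (j + 1), c i - c 0)

variable {H : Type*} [NormedAddCommGroup H] [InnerProductSpace ℝ H] {T : H →ₗ[ℝ] H}

/-- The partial sums `x + T x + ⋯ + T ^ (n - 1) x`. -/
def powSum (T : H →ₗ[ℝ] H) (x : H) (n : ℕ) : H := ∑ k ∈ Finset.range n, (T ^ k) x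

lemma inner_pow_pow (hT : T.IsSymmetric) (x : H) (i j : ℕ) :
    inner ℝ ((T ^ i) x) ((T ^ j) x) = inner ℝ x ((T ^ (i + j)) x) := by
  induction i generalizing j with
  | zero => simp
  | succ i ih =>
    rw [pow_succ', Module.End.mul_apply, hT, ← Module.End.mul_apply, ← pow_succ', ih]
    congr 3; ring

lemma norm_pow_apply_le (hc : ∀ x, ‖T x‖ ≤ ‖x‖) (x : H) (n : ℕ) : ‖(T ^ n) x‖ ≤ ‖x‖ := by
  induction n with
  | zero => simp
  | succ n ih => rw [pow_succ', Module.End.mul_apply]; exact (hc _).trans ih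

/-- The right side is twice the sum over `l ≤ i` of `‖T^l x + T^(l+1) x‖²`. It is the increment of
the variance from `2 i + 1` to `2 i + 3`. -/
lemma varSeq_odd_increment (hT : T.IsSymmetric) (x : H) (i : ℕ) :
    0 ≤ 4 * ∑ k ∈ Finset.range (2 * i + 2), (inner ℝ x ((T ^ k) x) : ℝ)
      + 2 * inner ℝ x ((T ^ (2 * i + 2)) x) - 2 * inner ℝ x ((T ^ 0) x) := by
  have key : ∀ l : ℕ, 0 ≤ (inner ℝ x ((T ^ (2 * l)) x) : ℝ) + 2 * inner ℝ x ((T ^ (2 * l + 1)) x)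
      + inner ℝ x ((T ^ (2 * l + 2)) x) := fun l => by
    have h : (0 : ℝ) ≤ inner ℝ ((T ^ l) x + (T ^ (l + 1)) x) ((T ^ l) x + (T ^ (l + 1)) x) :=
      real_inner_self_nonneg
    simp only [inner_add_left, inner_add_right, inner_pow_pow hT] at h
    rw [show l + l = 2 * l by ring, show l + (l + 1) = 2 * l + 1 by ring,
      show l + 1 + l = 2 * l + 1 by ring, show l + 1 + (l + 1) = 2 * l + 2 by ring] at h
    linarith
  induction i with
  | zero => have := key 0; simp [Finset.sum_range_succ] at this ⊢; linarith
  | succ i ih =>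
    have := key (i + 1)
    rw [show 2 * (i + 1) = 2 * i + 2 by ring] at this ⊢
    rw [Finset.sum_range_succ, Finset.sum_range_succ]
    linarith

/-- Only odd indices can be hoped for: with `T = -1` the variance alternates between `0` and `‖x‖²`.
-/
lemma varSeq_odd_mono (hT : T.IsSymmetric) (x : H) :
    Monotone fun i : ℕ => varSeq (fun k => inner ℝ x ((T ^ k) x)) (2 * i + 1) := by
  refine monotone_nat_of_le_succ fun i => ?_
  have := varSeq_odd_increment hT x i
  rw [show 2 * (i + 1) + 1 = 2 * i + 1 + 1 + 1 by ring]
  simp only [varSeq]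
  rw [Finset.sum_range_succ _ (2 * i + 1 + 1), Finset.sum_range_succ _ (2 * i + 1),
    Finset.sum_range_succ _ (2 * i + 1 + 1)]
  rw [show 2 * i + 1 + 1 = 2 * i + 2 by ring]
  linarith

/-- Both sides count each lag `i + j + 1` with `i, j < n`: by symmetry of `T` on the left, and on
the right as twice the covariance between the first and the second block of length `n`. -/
lemma inner_powSum_map (hT : T.IsSymmetric) (x : H) (n : ℕ) :
    2 * inner ℝ (powSum T x n) (T (powSum T x n)) =
      varSeq (fun k => inner ℝ x ((T ^ k) x)) (2 * n)
        - 2 * varSeq (fun k => inner ℝ x ((T ^ k) x)) n := by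
  induction n with
  | zero => simp [powSum, varSeq]
  | succ n ih =>
    have h1 : powSum T x (n + 1) = powSum T x n + (T ^ n) x := Finset.sum_range_succ _ _
    have h2 : (inner ℝ (powSum T x n) (T ((T ^ n) x)) : ℝ) =
        ∑ j ∈ Finset.range n, inner ℝ x ((T ^ (n + 1 + j)) x) := by
      rw [powSum, sum_inner]
      refine Finset.sum_congr rfl fun j _ => ?_
      rw [← Module.End.mul_apply, ← pow_succ', inner_pow_pow hT, add_comm]
    have h3 : (inner ℝ ((T ^ n) x) (T (powSum T x n)) : ℝ) =
        ∑ j ∈ Finset.range n, inner ℝ x ((T ^ (n + 1 + j)) x) := by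
      rw [← hT, real_inner_comm, h2]
    have h4 : (inner ℝ ((T ^ n) x) (T ((T ^ n) x)) : ℝ) = inner ℝ x ((T ^ (2 * n + 1)) x) := by
      rw [← Module.End.mul_apply, ← pow_succ', inner_pow_pow hT]; congr 3; ring
    have h5 : ∑ k ∈ Finset.range (2 * n + 1), (inner ℝ x ((T ^ k) x) : ℝ) =
        ∑ k ∈ Finset.range (n + 1), (inner ℝ x ((T ^ k) x) : ℝ) +
          ∑ j ∈ Finset.range n, inner ℝ x ((T ^ (n + 1 + j)) x) := by
      rw [show 2 * n + 1 = n + 1 + n by ring, Finset.sum_range_add]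
    rw [h1, map_add, inner_add_left, inner_add_right, inner_add_right, h2, h3, h4,
      show 2 * (n + 1) = 2 * n + 1 + 1 by ring]
    simp only [varSeq] at ih ⊢
    rw [Finset.sum_range_succ _ (2 * n + 1), Finset.sum_range_succ _ (2 * n),
      Finset.sum_range_succ _ (2 * n + 1), Finset.sum_range_succ _ n, h5]
    linarith

lemma powSum_sub_map (x : H) (n : ℕ) : powSum T x n - T (powSum T x n) = x - (T ^ n) x := by
  induction n with
  | zero => simp [powSum]
  | succ n ih =>
    have h1 : powSum T x (n + 1) = powSum T x n + (T ^ n) x := Finset.sum_range_succ _ _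
    rw [h1, map_add, add_sub_add_comm, ih, ← Module.End.mul_apply, ← pow_succ']
    abel

/-- Replacing `T V` by `V` in `inner_powSum_map` costs `⟨V, x - T^n x⟩ ≤ 2 ‖V‖ ‖x‖ ≤ ‖V‖² / 2 + 2
‖x‖²`, and half of `‖V‖²` is absorbed. -/
lemma norm_powSum_sq_le (hT : T.IsSymmetric) (hc : ∀ x, ‖T x‖ ≤ ‖x‖) (x : H) (n : ℕ) :
    ‖powSum T x n‖ ^ 2 ≤ varSeq (fun k => inner ℝ x ((T ^ k) x)) (2 * n)
        - 2 * varSeq (fun k => inner ℝ x ((T ^ k) x)) n + 4 * ‖x‖ ^ 2 := by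
  rw [← inner_powSum_map hT]
  set V := powSum T x n with hV
  have h1 : ‖V‖ ^ 2 = inner ℝ V (T V) + inner ℝ V (x - (T ^ n) x) := by
    rw [← powSum_sub_map, ← hV, ← inner_add_right, add_sub_cancel, real_inner_self_eq_norm_sq]
  have h2 : (inner ℝ V (x - (T ^ n) x) : ℝ) ≤ ‖V‖ * (2 * ‖x‖) := by
    refine (real_inner_le_norm _ _).trans ?_
    gcongr
    have := norm_sub_le x ((T ^ n) x)
    have := norm_pow_apply_le hc x n
    linarith
  nlinarith [sq_nonneg (‖V‖ - 2 * ‖x‖)]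

end Hilbert

/-! ### Growth of the standard deviations. -/

section Sequences

variable {σ : ℕ → ℝ} {C : ℝ}

/-- An even index is moved to an odd neighbour at cost `C`; at most two such moves are needed. -/
lemma le_add_of_odd_mono (h0 : ∀ n, 0 ≤ σ n) (hodd : Monotone fun i : ℕ => σ (2 * i + 1) ^ 2)
    (hC : 0 ≤ C) (hstep : ∀ n, |σ (n + 1) - σ n| ≤ C) (hz : σ 0 ≤ C) {j n : ℕ} (hjn : j ≤ n) :
    σ j ≤ σ n + 2 * C := by
  have hmono : ∀ a b : ℕ, a ≤ b → σ (2 * a + 1) ≤ σ (2 * b + 1) := fun a b hab =>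
    (sq_le_sq₀ (h0 _) (h0 _)).1 (hodd hab)
  rcases Nat.even_or_odd' j with ⟨a, rfl | rfl⟩ <;> rcases Nat.even_or_odd' n with ⟨b, rfl | rfl⟩
  · rcases eq_or_ne a 0 with rfl | ha
    · have := h0 (2 * b); simp only [mul_zero]; linarith
    · obtain ⟨a', rfl⟩ := Nat.exists_eq_succ_of_ne_zero ha
      obtain ⟨b', rfl⟩ : ∃ b', b = b' + 1 := ⟨b - 1, by omega⟩
      have h1 := abs_le.1 (hstep (2 * a' + 1))
      have h2 := abs_le.1 (hstep (2 * b' + 1))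
      have h3 := hmono a' b' (by omega)
      simp only [Nat.succ_eq_add_one, show 2 * (a' + 1) = 2 * a' + 1 + 1 by ring,
        show 2 * (b' + 1) = 2 * b' + 1 + 1 by ring]
      linarith
  · have h1 := abs_le.1 (hstep (2 * a))
    have h3 := hmono a b (by omega)
    linarith
  · obtain ⟨b', rfl⟩ : ∃ b', b = b' + 1 := ⟨b - 1, by omega⟩
    have h2 := abs_le.1 (hstep (2 * b' + 1))
    have h3 := hmono a b' (by omega)
    simp only [show 2 * (b' + 1) = 2 * b' + 1 + 1 by ring]
    linarith
  · have h3 := hmono a b (by omega)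
    linarith

lemma tendsto_atTop_of_doubling (hle : ∀ j n, j ≤ n → σ j ≤ σ n + C) (h0 : ∀ n, 0 ≤ σ n)
    (hpos : ∀ᶠ n in atTop, 0 < σ n)
    (hr : Tendsto (fun n => σ (2 * n) ^ 2 / σ n ^ 2) atTop (𝓝 2)) : Tendsto σ atTop atTop := by
  -- The ratio of squares eventually exceeds `9 / 8 > (33 / 32) ^ 2`, so `σ` grows by a factor `33 /
  -- 32` at each doubling; `hle` then covers the indices in between.
  obtain ⟨N, hN⟩ := eventually_atTop.1
    (hpos.and (hr.eventually (lt_mem_nhds (show (9 / 4 / 2 : ℝ) < 2 by norm_num))))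
  have hstep : ∀ n, N ≤ n → 33 / 32 * σ n ≤ σ (2 * n) := fun n hn => by
    obtain ⟨hp, hq⟩ := hN n hn
    rw [lt_div_iff₀ (by positivity)] at hq
    by_contra! hcon
    have := h0 (2 * n)
    nlinarith
  have hpow : ∀ k : ℕ, (33 / 32 : ℝ) ^ k * σ (N + 1) ≤ σ (2 ^ k * (N + 1)) := fun k => by
    induction k with
    | zero => simp
    | succ k ih =>
      have h1 : N ≤ 2 ^ k * (N + 1) :=
        (Nat.le_succ N).trans (Nat.le_mul_of_pos_left _ (by positivity))
      have h2 := hstep _ h1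
      rw [← mul_assoc, ← pow_succ'] at h2
      rw [pow_succ']
      linarith
  have hp : 0 < σ (N + 1) := (hN _ (Nat.le_succ N)).1
  refine tendsto_atTop.2 fun b => ?_
  obtain ⟨k, hk⟩ := (((tendsto_pow_atTop_atTop_of_one_lt (by norm_num : (1 : ℝ) < 33 / 32)).atTop_mul_const
    hp).eventually_ge_atTop (b + C)).exists
  filter_upwards [eventually_ge_atTop (2 ^ k * (N + 1))] with n hn
  linarith [hle _ _ hn, hpow k]

/-- For `j` beyond a fixed `N` the doubling ratio gives `v j ≤ (ε / 4) σ_j² + K`, and `σ_j² ≤ 2 σ_n²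
+ 2 C²`. The finitely many smaller `j` are dominated because `σ_n → ∞`. -/
lemma eventually_forall_le_mul_sq {v : ℕ → ℝ} {K : ℝ}
    (hle : ∀ j n, j ≤ n → σ j ≤ σ n + C) (h0 : ∀ n, 0 ≤ σ n)
    (hpos : ∀ᶠ n in atTop, 0 < σ n)
    (hr : Tendsto (fun n => σ (2 * n) ^ 2 / σ n ^ 2) atTop (𝓝 2))
    (hv : ∀ n, v n ≤ σ (2 * n) ^ 2 - 2 * σ n ^ 2 + K) {ε : ℝ} (hε : 0 < ε) :
    ∀ᶠ n in atTop, ∀ j ≤ n, v j ≤ ε * σ n ^ 2 := by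
  have hinf := tendsto_atTop_of_doubling hle h0 hpos hr
  obtain ⟨N, hN⟩ := eventually_atTop.1
    (hpos.and (hr.eventually (gt_mem_nhds (show (2 : ℝ) < 2 + ε / 4 by linarith))))
  have hsq : Tendsto (fun n => ε / 2 * σ n ^ 2) atTop atTop :=
    ((tendsto_pow_atTop two_ne_zero).comp hinf).const_mul_atTop (by positivity)
  filter_upwards [hsq.eventually_ge_atTop (∑ j ∈ Finset.range N, |v j|),
    hsq.eventually_ge_atTop (ε / 2 * C ^ 2 + K)] with n h1 h2 j hj
  rcases lt_or_ge j N with hjN | hjN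
  · have := Finset.single_le_sum (f := fun j => |v j|) (fun _ _ => abs_nonneg _)
      (Finset.mem_range.2 hjN)
    have h3 := le_abs_self (v j)
    have h4 : 0 ≤ ε / 2 * σ n ^ 2 := by positivity
    linarith
  · obtain ⟨hp, hq⟩ := hN j hjN
    rw [div_lt_iff₀ (by positivity)] at hq
    have h3 : σ j ^ 2 ≤ 2 * σ n ^ 2 + 2 * C ^ 2 := by
      have := hle j n hj
      have h5 := h0 j
      nlinarith [sq_nonneg (σ n - C), h0 n]
    nlinarith [hv j]

end Sequences
-- Taylor estimates for the exponential.
section Scalar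

/-- The cubic bound serves small increments and the quadratic one the large increments in the
Lindeberg term. -/
lemma norm_exp_sub_taylor_two_le (x : ℝ) :
    ‖Complex.exp (x * Complex.I) - 1 - x * Complex.I + x ^ 2 / 2‖ ≤ 4 * min (|x| ^ 3) (x ^ 2) := by
  rcases le_or_gt |x| 1 with hx | hx
  · have h := Complex.exp_bound (x := x * Complex.I) (by simpa using hx) (n := 3) (by norm_num)
    have h1 : Complex.exp (x * Complex.I) - 1 - x * Complex.I + x ^ 2 / 2 =
        Complex.exp (x * Complex.I) -
          ∑ m ∈ Finset.range 3, (x * Complex.I : ℂ) ^ m / (m.factorial : ℂ) := by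
      simp [Finset.sum_range_succ, mul_pow]; ring
    rw [h1]
    refine h.trans ?_
    have h2 : |x| ^ 3 ≤ x ^ 2 := by
      rw [← sq_abs, pow_succ]
      exact mul_le_of_le_one_right (by positivity) hx
    rw [min_eq_left h2]
    have h3 : (0 : ℝ) ≤ |x| ^ 3 := by positivity
    simp [Nat.factorial]
    linarith
  · have h2 : x ^ 2 ≤ |x| ^ 3 := by
      rw [← sq_abs, pow_succ]
      exact le_mul_of_one_le_right (by positivity) hx.le
    rw [min_eq_right h2]
    have h3 : ‖Complex.exp (x * Complex.I)‖ = 1 := Complex.norm_exp_ofReal_mul_I x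
    have h4 : ‖(x * Complex.I : ℂ)‖ = |x| := by simp
    have h5 : ‖(x ^ 2 / 2 : ℂ)‖ = x ^ 2 / 2 := by
      rw [norm_div, norm_pow, Complex.norm_real]; simp
    have h6 := norm_add_le (Complex.exp (x * Complex.I) - 1 - x * Complex.I) (x ^ 2 / 2 : ℂ)
    have h7 := norm_sub_le (Complex.exp (x * Complex.I) - 1) (x * Complex.I : ℂ)
    have h8 := norm_sub_le (Complex.exp (x * Complex.I)) 1
    have h9 : |x| ≤ x ^ 2 := by rw [← sq_abs]; nlinarith
    rw [norm_one] at h8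
    nlinarith

lemma abs_exp_neg_sub_taylor_le {y : ℝ} (hy : 0 ≤ y) : |Real.exp (-y) - 1 + y| ≤ y ^ 2 := by
  rw [abs_of_nonneg (by linarith [Real.one_sub_le_exp_neg y])]
  rcases le_or_gt y 1 with h | h
  · have := Real.abs_exp_sub_one_sub_id_le (x := -y) (by rwa [abs_neg, abs_of_nonneg hy])
    have := (abs_le.1 this).2
    nlinarith
  · have := Real.exp_le_one_iff.2 (neg_nonpos.2 hy)
    nlinarith

end Scalar

/-! ### Conditional expectations and bounded convergence. -/

section CondExp

variable {Ω : Type*} {m m0 : MeasurableSpace Ω} {P : Measure Ω} [IsProbabilityMeasure P]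

lemma integral_condExp_smul {E : Type*} [NormedAddCommGroup E] [NormedSpace ℝ E] [CompleteSpace E]
    (hm : m ≤ m0) {f : Ω → ℝ} {G : Ω → E} {B : ℝ} (hG : StronglyMeasurable[m] G)
    (hB : ∀ ω, ‖G ω‖ ≤ B) (hf : Integrable f P) :
    ∫ ω, (P[f | m]) ω • G ω ∂P = ∫ ω, f ω • G ω ∂P := by
  have hint : Integrable (fun ω => f ω • G ω) P :=
    hf.smul_bdd B (hG.mono hm).aestronglyMeasurable (ae_of_all _ hB)
  have h := condExp_bilin_of_stronglyMeasurable_left (m := m) (μ := P)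
    (ContinuousLinearMap.lsmul ℝ ℝ (E := E)).flip hG (by simpa using hint) hf
  simp only [ContinuousLinearMap.flip_apply, ContinuousLinearMap.lsmul_apply] at h
  rw [← integral_condExp hm (f := fun ω => f ω • G ω)]
  exact (integral_congr_ae h).symm

/-- The `L¹` norm of a conditional expectation is at most the supremum of the pairings with
functions of modulus at most one. -/
lemma integral_norm_condExp_le (hm : m ≤ m0) {X : Ω → ℂ} (hX : Integrable X P) {δ : ℝ}
    (h : ∀ Y : Ω → ℂ, StronglyMeasurable[m] Y → (∀ ω, ‖Y ω‖ ≤ 1) → ‖∫ ω, Y ω * X ω ∂P‖ ≤ δ) :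
    ∫ ω, ‖(P[X | m]) ω‖ ∂P ≤ δ := by
  set Z := P[X | m] with hZ
  have hZm : StronglyMeasurable[m] Z := stronglyMeasurable_condExp
  -- The conjugate phase of `Z`, so that `Y Z = ‖Z‖`; where `Z = 0` the quotient is `0`, which keeps
  -- `‖Y‖ ≤ 1`.
  set Y : Ω → ℂ := fun ω => (starRingEnd ℂ) (Z ω) / ‖Z ω‖ with hY
  have hYm : StronglyMeasurable[m] Y :=
    ((Complex.continuous_conj.measurable.comp hZm.measurable).div
      (Complex.measurable_ofReal.comp hZm.norm.measurable)).stronglyMeasurable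
  have hY1 : ∀ ω, ‖Y ω‖ ≤ 1 := fun ω => by
    simp only [hY, norm_div, RCLike.norm_conj, Complex.norm_real, norm_norm]
    exact div_self_le_one _
  have hint : Integrable (fun ω => Y ω * X ω) P :=
    hX.bdd_mul (c := 1) (hYm.mono hm).aestronglyMeasurable (ae_of_all _ hY1)
  have hpull := condExp_bilin_of_stronglyMeasurable_left (m := m) (μ := P)
    (ContinuousLinearMap.mul ℝ ℂ) hYm (by simpa using hint) hX
  simp only [ContinuousLinearMap.mul_apply'] at hpull
  have hYZ : ∀ ω, Y ω * Z ω = (‖Z ω‖ : ℂ) := fun ω => by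
    simp only [hY]
    rcases eq_or_ne (Z ω) 0 with h0 | h0
    · simp [h0]
    · have : (‖Z ω‖ : ℂ) ≠ 0 := by simpa using h0
      rw [div_mul_eq_mul_div, div_eq_iff this, ← Complex.normSq_eq_conj_mul_self,
        Complex.normSq_eq_norm_sq]
      push_cast; ring
  have h1 : ∫ ω, Y ω * X ω ∂P = ((∫ ω, ‖Z ω‖ ∂P : ℝ) : ℂ) := by
    rw [← integral_condExp hm (f := fun ω => Y ω * X ω), integral_congr_ae hpull,
      ← integral_complex_ofReal]
    exact integral_congr_ae (ae_of_all _ hYZ)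
  have h2 := h Y hYm hY1
  rw [h1, Complex.norm_real, Real.norm_of_nonneg (integral_nonneg fun _ => norm_nonneg _)] at h2
  exact h2

/-- Bounded convergence in probability: the integral is at most `ε` plus `|K|` times the probability
of exceeding `ε`. -/
lemma tendsto_integral_of_tendsto_measure {U : ℕ → Ω → ℝ} {K : ℝ}
    (hU : ∀ n, AEStronglyMeasurable (U n) P) (h0 : ∀ n, 0 ≤ᵐ[P] U n)
    (hK : ∀ n, ∀ᵐ ω ∂P, U n ω ≤ K)
    (h : ∀ ε : ℝ, 0 < ε → Tendsto (fun n => P {ω | ε ≤ U n ω}) atTop (𝓝 0)) :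
    Tendsto (fun n => ∫ ω, U n ω ∂P) atTop (𝓝 0) := by
  have hint : ∀ n, Integrable (U n) P := fun n =>
    Integrable.of_bound (hU n) K (by
      filter_upwards [h0 n, hK n] with ω h1 h2
      rw [Real.norm_of_nonneg h1]; exact h2)
  have hbound : ∀ ε : ℝ, 0 < ε → ∀ n, ∫ ω, U n ω ∂P ≤ ε + |K| * P.real {ω | ε ≤ U n ω} := by
    intro ε hε n
    have hs : NullMeasurableSet {ω | ε ≤ U n ω} P :=
      nullMeasurableSet_le aemeasurable_const (hU n).aemeasurable
    have h1 : ∫ ω, U n ω ∂P ≤ ∫ ω, (ε + {ω | ε ≤ U n ω}.indicator (fun _ => |K|) ω) ∂P := by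
      refine integral_mono_ae (hint n)
        ((integrable_const _).add ((integrable_const _).indicator₀ hs)) ?_
      filter_upwards [hK n] with ω h2
      by_cases hω : ε ≤ U n ω
      · simp only [Set.indicator, Set.mem_ofPred_eq, hω, if_true]
        linarith [le_abs_self K]
      · simp only [Set.indicator, Set.mem_ofPred_eq, hω, if_false]
        linarith
    rw [integral_add (integrable_const _) ((integrable_const _).indicator₀ hs),
      integral_indicator₀ hs] at h1
    simpa [mul_comm] using h1
  refine tendsto_order.2 ⟨fun a ha => Eventually.of_forall fun n =>
    ha.trans_le (integral_nonneg_of_ae (h0 n)), fun a ha => ?_⟩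
  have h1 : Tendsto (fun n => a / 2 + |K| * P.real {ω | a / 2 ≤ U n ω}) atTop
      (𝓝 (a / 2 + |K| * 0)) := by
    refine tendsto_const_nhds.add (Tendsto.const_mul _ ?_)
    exact (ENNReal.tendsto_toReal_zero_iff (fun _ => measure_ne_top _ _)).2 (h _ (half_pos ha))
  filter_upwards [h1.eventually (gt_mem_nhds (by linarith : a / 2 + |K| * 0 < a))] with n hn
  exact (hbound _ (half_pos ha) n).trans_lt hn

end CondExp

/-! ### One step of the Lindeberg replacement. -/

section OneStep

variable {Ω : Type*} {m m0 : MeasurableSpace Ω} {P : Measure Ω} [IsProbabilityMeasure P]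

/-- Conditioning gives `E s² = E ξ² s`. Where `|ξ| ≤ ε` the integrand is at most `ε² s`, and
elsewhere at most `c ξ²`. -/
lemma integral_sq_condVar_le (hm : m ≤ m0) {ξ s : Ω → ℝ} {c ε : ℝ}
    (hξ : MemLp ξ 2 P) (hs : StronglyMeasurable[m] s) (hs0 : ∀ ω, 0 ≤ s ω)
    (hsc : ∀ ω, s ω ≤ c) (hvar : P[fun ω => ξ ω ^ 2 | m] =ᵐ[P] s) :
    ∫ ω, s ω ^ 2 ∂P ≤ ε ^ 2 * ∫ ω, s ω ∂P
      + c * ∫ ω, {ω | ε < |ξ ω|}.indicator (fun ω => ξ ω ^ 2) ω ∂P := by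
  have hsn : ∀ ω, ‖s ω‖ ≤ c := fun ω => by rw [Real.norm_of_nonneg (hs0 ω)]; exact hsc ω
  have hsi : Integrable s P := .of_bound (hs.mono hm).aestronglyMeasurable c (ae_of_all _ hsn)
  have hset : NullMeasurableSet {ω | ε < |ξ ω|} P :=
    nullMeasurableSet_lt aemeasurable_const hξ.1.norm.aemeasurable
  have hind : Integrable ({ω | ε < |ξ ω|}.indicator fun ω => ξ ω ^ 2) P :=
    hξ.integrable_sq.indicator₀ hset
  have h1 : ∫ ω, s ω ^ 2 ∂P = ∫ ω, ξ ω ^ 2 * s ω ∂P := by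
    have := integral_condExp_smul hm hs hsn hξ.integrable_sq
    simp only [smul_eq_mul] at this
    rw [← this]
    refine integral_congr_ae ?_
    filter_upwards [hvar] with ω hω
    rw [hω, sq]
  rw [h1, ← integral_const_mul, ← integral_const_mul,
    ← integral_add (hsi.const_mul _) (hind.const_mul _)]
  refine integral_mono (hξ.integrable_sq.mul_bdd (c := c) (hs.mono hm).aestronglyMeasurable
    (ae_of_all _ hsn)) ((hsi.const_mul _).add (hind.const_mul _)) fun ω => ?_
  by_cases hω : ε < |ξ ω|
  · simp only [Set.indicator, Set.mem_ofPred_eq, hω, if_true]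
    nlinarith [hs0 ω, hsc ω, sq_nonneg (ξ ω), mul_nonneg (sq_nonneg ε) (hs0 ω)]
  · simp only [Set.indicator, Set.mem_ofPred_eq, hω, if_false, mul_zero, add_zero]
    have : ξ ω ^ 2 ≤ ε ^ 2 := by
      rw [← sq_abs]; exact pow_le_pow_left₀ (abs_nonneg _) (not_lt.1 hω) 2
    exact mul_le_mul_of_nonneg_right this (hs0 ω)

/-- Replacing a martingale difference by its Gaussian counterpart in a characteristic function. -/
lemma norm_integral_mul_exp_sub_exp_le (hm : m ≤ m0) {ξ s : Ω → ℝ} {c ε B : ℝ} (hε : 0 ≤ ε)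
    (hB0 : 0 ≤ B)
    (hξ : MemLp ξ 2 P) (hs : StronglyMeasurable[m] s) (hs0 : ∀ ω, 0 ≤ s ω)
    (hsc : ∀ ω, s ω ≤ c) (hvar : P[fun ω => ξ ω ^ 2 | m] =ᵐ[P] s) (hmean : P[ξ | m] =ᵐ[P] 0)
    {G : Ω → ℂ} (hG : StronglyMeasurable[m] G) (hB : ∀ ω, ‖G ω‖ ≤ B) (t : ℝ) :
    ‖∫ ω, G ω * (Complex.exp ((t * ξ ω : ℝ) * Complex.I) - Real.exp (-(t ^ 2 * s ω / 2))) ∂P‖ ≤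
      B * ((4 * |t| ^ 3 * ε + t ^ 4 / 4 * ε ^ 2) * ∫ ω, s ω ∂P
        + (4 * t ^ 2 + t ^ 4 / 4 * c) *
          ∫ ω, {ω | ε < |ξ ω|}.indicator (fun ω => ξ ω ^ 2) ω ∂P) := by
  have hsn : ∀ ω, ‖s ω‖ ≤ c := fun ω => by rw [Real.norm_of_nonneg (hs0 ω)]; exact hsc ω
  have hsi : Integrable s P := .of_bound (hs.mono hm).aestronglyMeasurable c (ae_of_all _ hsn)
  have hss : Integrable (fun ω => s ω ^ 2) P := by
    refine .of_bound ((hs.mono hm).pow 2).aestronglyMeasurable (c ^ 2) (ae_of_all _ fun ω => ?_)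
    rw [norm_pow]; exact pow_le_pow_left₀ (norm_nonneg _) (hsn ω) 2
  have hset : NullMeasurableSet {ω | ε < |ξ ω|} P :=
    nullMeasurableSet_lt aemeasurable_const hξ.1.norm.aemeasurable
  have hind : Integrable ({ω | ε < |ξ ω|}.indicator fun ω => ξ ω ^ 2) P :=
    hξ.integrable_sq.indicator₀ hset
  have hGa : AEStronglyMeasurable G P := (hG.mono hm).aestronglyMeasurable
  have hξi : Integrable ξ P := hξ.integrable (by norm_num)
  have hGB : ∀ᵐ ω ∂P, ‖G ω‖ ≤ B := ae_of_all _ hB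
  have hi1 : Integrable (fun ω => ξ ω • G ω) P := hξi.smul_bdd B hGa hGB
  have hi2 : Integrable (fun ω => (ξ ω ^ 2) • G ω) P := hξ.integrable_sq.smul_bdd B hGa hGB
  have hi3 : Integrable (fun ω => s ω • G ω) P := hsi.smul_bdd B hGa hGB
  have hz1 : ∫ ω, ξ ω • G ω ∂P = 0 := by
    rw [← integral_condExp_smul hm hG hB hξi]
    refine integral_eq_zero_of_ae ?_
    filter_upwards [hmean] with ω hω
    simp [hω]
  have hz2 : ∫ ω, (ξ ω ^ 2) • G ω ∂P = ∫ ω, s ω • G ω ∂P := by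
    rw [← integral_condExp_smul hm hG hB hξ.integrable_sq]
    refine integral_congr_ae ?_
    filter_upwards [hvar] with ω hω
    rw [hω]
  have hexp : Integrable (fun ω => G ω * (Complex.exp ((t * ξ ω : ℝ) * Complex.I)
      - Real.exp (-(t ^ 2 * s ω / 2)))) P := by
    refine .of_bound (C := B * 2) (hGa.mul (AEStronglyMeasurable.sub ?_ ?_)) (ae_of_all _ fun ω => ?_)
    · have := hξ.1.aemeasurable
      exact (Complex.measurable_exp.comp_aemeasurable (by fun_prop)).aestronglyMeasurable
    · have := (hs.mono hm).measurable
      exact (Complex.measurable_ofReal.comp (Real.measurable_exp.comp (by fun_prop))).aestronglyMeasurable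
    · rw [norm_mul]
      have h2 : ‖((Real.exp (-(t ^ 2 * s ω / 2)) : ℝ) : ℂ)‖ ≤ 1 := by
        rw [Complex.norm_real, Real.norm_of_nonneg (Real.exp_nonneg _), Real.exp_le_one_iff]
        have := hs0 ω
        have : 0 ≤ t ^ 2 * s ω / 2 := by positivity
        linarith
      have h3 := norm_sub_le (Complex.exp ((t * ξ ω : ℝ) * Complex.I))
        ((Real.exp (-(t ^ 2 * s ω / 2)) : ℝ) : ℂ)
      rw [Complex.norm_exp_ofReal_mul_I] at h3
      exact mul_le_mul (hB ω) (by linarith) (norm_nonneg _) hB0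
  -- Against the `m`-measurable `G` the linear term integrates to zero, and `ξ²` and `s` have equal
  -- integrals. So both exponentials may be replaced by their Taylor remainders, whose difference is
  -- `R`.
  set R : Ω → ℂ := fun ω =>
    (Complex.exp ((t * ξ ω : ℝ) * Complex.I) - 1 - (t * ξ ω : ℝ) * Complex.I
      + ((t * ξ ω : ℝ) : ℂ) ^ 2 / 2)
      - ((Real.exp (-(t ^ 2 * s ω / 2)) - 1 + t ^ 2 * s ω / 2 : ℝ) : ℂ) with hR
  have hdecomp : ∫ ω, G ω * (Complex.exp ((t * ξ ω : ℝ) * Complex.I)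
      - Real.exp (-(t ^ 2 * s ω / 2))) ∂P = ∫ ω, G ω * R ω ∂P := by
    have h1 : ∀ ω, G ω * R ω = G ω * (Complex.exp ((t * ξ ω : ℝ) * Complex.I)
        - Real.exp (-(t ^ 2 * s ω / 2))) - (t * Complex.I) * (ξ ω • G ω)
        + (t ^ 2 / 2 : ℂ) * ((ξ ω ^ 2) • G ω - s ω • G ω) := fun ω => by
      simp only [hR, Complex.real_smul]; push_cast; ring
    have h2 := integral_add (hexp.sub (hi1.const_mul (t * Complex.I)))
      ((hi2.sub hi3).const_mul (t ^ 2 / 2 : ℂ))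
    simp only [Pi.sub_apply] at h2
    simp_rw [h1]
    rw [h2, integral_sub hexp (hi1.const_mul _), integral_const_mul, integral_const_mul,
      integral_sub hi2 hi3, hz1, hz2]
    simp
  rw [hdecomp]
  have hpt : ∀ ω, ‖G ω * R ω‖ ≤ B * (4 * |t| ^ 3 * ε * ξ ω ^ 2
      + 4 * t ^ 2 * {ω | ε < |ξ ω|}.indicator (fun ω => ξ ω ^ 2) ω + t ^ 4 / 4 * s ω ^ 2) := by
    intro ω
    rw [norm_mul]
    refine mul_le_mul (hB ω) ?_ (norm_nonneg _) hB0
    refine (norm_sub_le _ _).trans ?_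
    have h1 := norm_exp_sub_taylor_two_le (t * ξ ω)
    have h2 : |Real.exp (-(t ^ 2 * s ω / 2)) - 1 + t ^ 2 * s ω / 2| ≤ (t ^ 2 * s ω / 2) ^ 2 :=
      abs_exp_neg_sub_taylor_le (by have := hs0 ω; positivity)
    rw [Complex.norm_real, Real.norm_eq_abs]
    have h3 : min (|t * ξ ω| ^ 3) ((t * ξ ω) ^ 2) ≤ |t| ^ 3 * ε * ξ ω ^ 2
        + t ^ 2 * {ω | ε < |ξ ω|}.indicator (fun ω => ξ ω ^ 2) ω := by
      by_cases hω : ε < |ξ ω|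
      · refine (min_le_right _ _).trans ?_
        simp only [Set.indicator, Set.mem_ofPred_eq, hω, if_true]
        have : 0 ≤ |t| ^ 3 * ε * ξ ω ^ 2 := by positivity
        rw [mul_pow]; linarith
      · refine (min_le_left _ _).trans ?_
        simp only [Set.indicator, Set.mem_ofPred_eq, hω, if_false, mul_zero, add_zero]
        rw [abs_mul, mul_pow, mul_assoc, ← sq_abs (ξ ω), pow_succ |ξ ω| 2, mul_comm ε]
        have := not_lt.1 hω
        gcongr
    have h4 : (t ^ 2 * s ω / 2) ^ 2 = t ^ 4 / 4 * s ω ^ 2 := by ring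
    linarith
  have hint1 : Integrable (fun ω => 4 * |t| ^ 3 * ε * ξ ω ^ 2) P := hξ.integrable_sq.const_mul _
  have hint2 : Integrable (fun ω => 4 * t ^ 2 *
      {ω | ε < |ξ ω|}.indicator (fun ω => ξ ω ^ 2) ω) P := hind.const_mul _
  have hint3 : Integrable (fun ω => t ^ 4 / 4 * s ω ^ 2) P := hss.const_mul _
  have h5 := norm_integral_le_of_norm_le (((hint1.add hint2).add hint3).const_mul B)
    (ae_of_all _ hpt)
  refine h5.trans ?_
  simp only [Pi.add_apply]
  have h9 := integral_add (hint1.add hint2) hint3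
  simp only [Pi.add_apply] at h9
  rw [integral_const_mul, h9, integral_add hint1 hint2,
    integral_const_mul, integral_const_mul, integral_const_mul]
  refine mul_le_mul_of_nonneg_left ?_ hB0
  have h6 : ∫ ω, ξ ω ^ 2 ∂P = ∫ ω, s ω ∂P := by
    rw [← integral_condExp hm, integral_congr_ae hvar]
  have h7 := integral_sq_condVar_le (ε := ε) hm hξ hs hs0 hsc hvar
  have h8 := mul_le_mul_of_nonneg_left h7 (by positivity : 0 ≤ t ^ 4 / 4)
  rw [h6]
  linarith

end OneStep

/-! ### The martingale central limit theorem, conditional on the initial `σ`-algebra. -/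

section MartingaleCLT

variable {Ω : Type*} {m0 : MeasurableSpace Ω} {P : Measure Ω} {ℱ : Filtration ℕ m0}
  {ξ s : ℕ → Ω → ℝ} {c : ℝ}

/-- `ξ` is a square integrable martingale difference sequence with conditional variances `s`. -/
structure IsMartingaleDiff (P : Measure Ω) (ℱ : Filtration ℕ m0) (ξ s : ℕ → Ω → ℝ) : Prop where
  adapted : ∀ k, StronglyMeasurable[ℱ (k + 1)] (ξ k)
  memLp : ∀ k, MemLp (ξ k) 2 P
  condExp_eq_zero : ∀ k, P[ξ k | ℱ k] =ᵐ[P] 0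
  predictable : ∀ k, StronglyMeasurable[ℱ k] (s k)
  nonneg : ∀ k ω, 0 ≤ s k ω
  condVar : ∀ k, P[fun ω => ξ k ω ^ 2 | ℱ k] =ᵐ[P] s k

/-- The event that the accumulated conditional variance does not exceed `c` after step `k`. -/
def varLE (s : ℕ → Ω → ℝ) (c : ℝ) (k : ℕ) : Set Ω := {ω | ∑ j ∈ Finset.range (k + 1), s j ω ≤ c}

/-- The variances are nonnegative, so the events decrease in `k`, and the sum stops before it passes
`c`. -/
lemma sum_indicator_varLE_le (hc : 0 ≤ c) (s : ℕ → Ω → ℝ) (hs : ∀ k ω, 0 ≤ s k ω) (n : ℕ) (ω : Ω) :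
    ∑ k ∈ Finset.range n, (varLE s c k).indicator (s k) ω ≤ c := by
  induction n with
  | zero => simpa using hc
  | succ n ih =>
    by_cases h : ω ∈ varLE s c n
    · exact (Finset.sum_le_sum fun k _ => Set.indicator_le_self' (fun _ _ => hs k _) ω).trans h
    · rw [Finset.sum_range_succ, Set.indicator_of_notMem h, add_zero]
      exact ih

lemma mem_varLE_of_le (hs : ∀ k ω, 0 ≤ s k ω) {n : ℕ} {ω : Ω}
    (h : ∑ j ∈ Finset.range n, s j ω ≤ c) {k : ℕ} (hk : k < n) : ω ∈ varLE s c k :=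
  (Finset.sum_le_sum_of_subset_of_nonneg (Finset.range_subset_range.2 hk)
    fun _ _ _ => hs _ _).trans h

lemma IsMartingaleDiff.stronglyMeasurable_sum (h : IsMartingaleDiff P ℱ ξ s) {n k : ℕ}
    (hnk : n ≤ k) : StronglyMeasurable[ℱ k] fun ω => ∑ j ∈ Finset.range n, ξ j ω :=
  Finset.stronglyMeasurable_fun_sum _ fun j hj =>
    (h.adapted j).mono (ℱ.mono (by have := Finset.mem_range.1 hj; omega))

lemma IsMartingaleDiff.stronglyMeasurable_sum_var (h : IsMartingaleDiff P ℱ ξ s) (k : ℕ) :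
    StronglyMeasurable[ℱ k] fun ω => ∑ j ∈ Finset.range (k + 1), s j ω :=
  Finset.stronglyMeasurable_fun_sum _ fun j hj =>
    (h.predictable j).mono (ℱ.mono (by have := Finset.mem_range.1 hj; omega))

lemma IsMartingaleDiff.measurableSet_varLE (h : IsMartingaleDiff P ℱ ξ s) (c : ℝ) (k : ℕ) :
    MeasurableSet[ℱ k] (varLE s c k) :=
  (h.stronglyMeasurable_sum_var k).measurable measurableSet_Iic

variable [IsProbabilityMeasure P]

/-- A martingale difference sequence stopped when its accumulated conditional variance is about to
exceed `c`. -/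
lemma IsMartingaleDiff.truncate (h : IsMartingaleDiff P ℱ ξ s) (c : ℝ) :
    IsMartingaleDiff P ℱ (fun k => (varLE s c k).indicator (ξ k))
      (fun k => (varLE s c k).indicator (s k)) where
  adapted k := (h.adapted k).indicator (ℱ.mono (Nat.le_succ k) _ (h.measurableSet_varLE c k))
  memLp k := (h.memLp k).indicator (ℱ.le k _ (h.measurableSet_varLE c k))
  condExp_eq_zero k := by
    refine (condExp_indicator ((h.memLp k).integrable (by norm_num))
      (h.measurableSet_varLE c k)).trans ?_
    filter_upwards [h.condExp_eq_zero k] with ω hω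
    simp [Set.indicator, hω]
  predictable k := (h.predictable k).indicator (h.measurableSet_varLE c k)
  nonneg k ω := Set.indicator_nonneg (fun _ _ => h.nonneg k _) ω
  condVar k := by
    have h1 : (fun ω => (varLE s c k).indicator (ξ k) ω ^ 2) =
        (varLE s c k).indicator fun ω => ξ k ω ^ 2 := by
      ext ω; by_cases hω : ω ∈ varLE s c k <;> simp [hω]
    rw [h1]
    refine (condExp_indicator (h.memLp k).integrable_sq (h.measurableSet_varLE c k)).trans ?_
    filter_upwards [h.condVar k] with ω hω
    simp [Set.indicator, hω]

lemma norm_exp_mul_exp_le {a b c : ℝ} (hbc : b ≤ c) :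
    ‖Complex.exp (a * Complex.I) * Real.exp b‖ ≤ Real.exp c := by
  rw [norm_mul, Complex.norm_exp_ofReal_mul_I, one_mul, Complex.norm_real,
    Real.norm_of_nonneg (Real.exp_nonneg _)]
  exact Real.exp_le_exp.2 hbc

lemma stronglyMeasurable_exp_mul_exp {m : MeasurableSpace Ω} {f g : Ω → ℝ}
    (hf : StronglyMeasurable f) (hg : StronglyMeasurable g) (t : ℝ) :
    StronglyMeasurable fun ω => Complex.exp ((t * f ω : ℝ) * Complex.I)
      * Real.exp (t ^ 2 * g ω / 2) := by
  have := hf.measurable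
  have := hg.measurable
  exact Measurable.stronglyMeasurable (by fun_prop)

/-- Let `A_k` be the accumulated conditional variance. The process `Y exp(i t M_k + t² A_k / 2)` is
almost a martingale. Since `A_{k+1}` is known at time `k`, its increment is the `ℱ k`-measurable
factor `Y exp(i t M_k + t² A_{k+1} / 2)`, bounded by `exp(t² c / 2)`, times the one-step difference
estimated above. The increments are summed, and `∑ E s_k ≤ c`. -/
lemma IsMartingaleDiff.norm_integral_exp_sub_one_le (h : IsMartingaleDiff P ℱ ξ s)
    (hA : ∀ n ω, ∑ k ∈ Finset.range n, s k ω ≤ c) {ε : ℝ} (hε : 0 ≤ ε) {Y : Ω → ℂ}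
    (hY : StronglyMeasurable[ℱ 0] Y) (hY1 : ∀ ω, ‖Y ω‖ ≤ 1) (t : ℝ) (n : ℕ) :
    ‖∫ ω, Y ω * (Complex.exp ((t * ∑ k ∈ Finset.range n, ξ k ω : ℝ) * Complex.I)
      * Real.exp (t ^ 2 * (∑ k ∈ Finset.range n, s k ω) / 2) - 1) ∂P‖ ≤
    Real.exp (t ^ 2 * c / 2) * ((4 * |t| ^ 3 * ε + t ^ 4 / 4 * ε ^ 2) * c
      + (4 * t ^ 2 + t ^ 4 / 4 * c) * ∑ k ∈ Finset.range n,
          ∫ ω, {ω | ε < |ξ k ω|}.indicator (fun ω => ξ k ω ^ 2) ω ∂P) := by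
  have hsc : ∀ k ω, s k ω ≤ c := fun k ω =>
    (Finset.single_le_sum (f := fun j => s j ω) (fun j _ => h.nonneg j ω)
      (Finset.mem_range.2 (Nat.lt_succ_self k))).trans (hA (k + 1) ω)
  have hsi : ∀ k, Integrable (s k) P := fun k =>
    .of_bound ((h.predictable k).mono (ℱ.le k)).aestronglyMeasurable c (ae_of_all _ fun ω => by
      rw [Real.norm_of_nonneg (h.nonneg k ω)]; exact hsc k ω)
  set Z : ℕ → Ω → ℂ := fun n ω => Y ω *
    (Complex.exp ((t * ∑ k ∈ Finset.range n, ξ k ω : ℝ) * Complex.I)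
      * Real.exp (t ^ 2 * (∑ k ∈ Finset.range n, s k ω) / 2)) with hZ
  have hexple : ∀ n ω, t ^ 2 * (∑ k ∈ Finset.range n, s k ω) / 2 ≤ t ^ 2 * c / 2 := fun n ω => by
    have := hA n ω
    gcongr
  have hZi : ∀ n, Integrable (Z n) P := fun n => by
    refine .of_bound (C := 1 * Real.exp (t ^ 2 * c / 2)) ?_ (ae_of_all _ fun ω => ?_)
    · refine ((hY.mono (ℱ.le 0)).mul (stronglyMeasurable_exp_mul_exp ?_ ?_ t)).aestronglyMeasurable
      · exact (h.stronglyMeasurable_sum le_rfl).mono (ℱ.le n)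
      · exact Finset.stronglyMeasurable_fun_sum _ fun j _ => (h.predictable j).mono (ℱ.le j)
    · rw [norm_mul]
      exact mul_le_mul (hY1 ω) (norm_exp_mul_exp_le (hexple n ω)) (norm_nonneg _) zero_le_one
  have hstep : ∀ k, ‖∫ ω, Z (k + 1) ω ∂P - ∫ ω, Z k ω ∂P‖ ≤ Real.exp (t ^ 2 * c / 2) *
      ((4 * |t| ^ 3 * ε + t ^ 4 / 4 * ε ^ 2) * ∫ ω, s k ω ∂P + (4 * t ^ 2 + t ^ 4 / 4 * c) *
          ∫ ω, {ω | ε < |ξ k ω|}.indicator (fun ω => ξ k ω ^ 2) ω ∂P) := fun k => by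
    have hG : StronglyMeasurable[ℱ k] fun ω => Y ω *
        (Complex.exp ((t * ∑ j ∈ Finset.range k, ξ j ω : ℝ) * Complex.I)
          * Real.exp (t ^ 2 * (∑ j ∈ Finset.range (k + 1), s j ω) / 2)) :=
      (hY.mono (ℱ.mono (Nat.zero_le k))).mul (stronglyMeasurable_exp_mul_exp
        (h.stronglyMeasurable_sum le_rfl) (h.stronglyMeasurable_sum_var k) t)
    have hGb := norm_integral_mul_exp_sub_exp_le (ℱ.le k) hε (Real.exp_nonneg (t ^ 2 * c / 2))
      (h.memLp k) (h.predictable k) (h.nonneg k) (hsc k) (h.condVar k) (h.condExp_eq_zero k) hG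
      (fun ω => by
        rw [norm_mul]
        exact (mul_le_of_le_one_left (norm_nonneg _) (hY1 ω)).trans
          (norm_exp_mul_exp_le (hexple _ ω))) t
    rw [← integral_sub (hZi _) (hZi _)]
    convert hGb using 2
    refine integral_congr_ae (ae_of_all _ fun ω => ?_)
    simp only [hZ]
    rw [Finset.sum_range_succ, Finset.sum_range_succ]
    have e1 : Complex.exp ((t * (∑ j ∈ Finset.range k, ξ j ω + ξ k ω) : ℝ) * Complex.I) =
        Complex.exp ((t * ∑ j ∈ Finset.range k, ξ j ω : ℝ) * Complex.I) *
          Complex.exp ((t * ξ k ω : ℝ) * Complex.I) := by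
      rw [← Complex.exp_add]; congr 1; push_cast; ring
    have e2 : Real.exp (t ^ 2 * (∑ j ∈ Finset.range k, s j ω) / 2) =
        Real.exp (t ^ 2 * (∑ j ∈ Finset.range k, s j ω + s k ω) / 2) *
          Real.exp (-(t ^ 2 * s k ω / 2)) := by
      rw [← Real.exp_add]; congr 1; ring
    rw [e1, e2]
    push_cast
    ring
  have hsum : ‖∫ ω, Z n ω ∂P - ∫ ω, Z 0 ω ∂P‖ ≤ ∑ k ∈ Finset.range n,
      Real.exp (t ^ 2 * c / 2) *
      ((4 * |t| ^ 3 * ε + t ^ 4 / 4 * ε ^ 2) * ∫ ω, s k ω ∂P + (4 * t ^ 2 + t ^ 4 / 4 * c) *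
          ∫ ω, {ω | ε < |ξ k ω|}.indicator (fun ω => ξ k ω ^ 2) ω ∂P) := by
    rw [← Finset.sum_range_sub (fun k => ∫ ω, Z k ω ∂P)]
    exact (norm_sum_le _ _).trans (Finset.sum_le_sum fun k _ => hstep k)
  have hZ0 : ∫ ω, Y ω * (Complex.exp ((t * ∑ k ∈ Finset.range n, ξ k ω : ℝ) * Complex.I)
      * Real.exp (t ^ 2 * (∑ k ∈ Finset.range n, s k ω) / 2) - 1) ∂P =
      ∫ ω, Z n ω ∂P - ∫ ω, Z 0 ω ∂P := by
    rw [← integral_sub (hZi _) (hZi _)]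
    refine integral_congr_ae (ae_of_all _ fun ω => ?_)
    simp [hZ, mul_sub]
  rw [hZ0]
  refine hsum.trans ?_
  rw [← Finset.mul_sum, Finset.sum_add_distrib, ← Finset.mul_sum, ← Finset.mul_sum]
  have hle : ∑ k ∈ Finset.range n, ∫ ω, s k ω ∂P ≤ c := by
    rw [← integral_finsetSum _ fun k _ => hsi k]
    have := integral_mono (integrable_finsetSum _ fun k _ => hsi k) (integrable_const c)
      (μ := P) (fun ω => hA n ω)
    simpa using this
  gcongr

/-- The stopping events lie in `ℱ k`, so each expectation is that of the conditional Lindeberg term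
on the event. These terms are at most `s n k`, so their stopped sum is bounded by `c`, and
convergence in probability passes to the mean. -/
lemma IsMartingaleDiff.tendsto_sum_integral_truncate {ξ s : ℕ → ℕ → Ω → ℝ}
    (h : ∀ n, IsMartingaleDiff P ℱ (ξ n) (s n)) (hc : 0 ≤ c) {ε : ℝ}
    (hlind : TendstoInMeasure P (fun n ω => ∑ k ∈ Finset.range n,
      (P[{ω' | ε < |ξ n k ω'|}.indicator (fun ω' => ξ n k ω' ^ 2) | ℱ k]) ω) atTop (fun _ => 0)) :
    Tendsto (fun n => ∑ k ∈ Finset.range n,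
      ∫ ω, {ω | ε < |(varLE (s n) c k).indicator (ξ n k) ω|}.indicator
        (fun ω => (varLE (s n) c k).indicator (ξ n k) ω ^ 2) ω ∂P) atTop (𝓝 0) := by
  set F : ℕ → ℕ → Ω → ℝ := fun n k => {ω' | ε < |ξ n k ω'|}.indicator (fun ω' => ξ n k ω' ^ 2)
    with hF
  have hset : ∀ n k, MeasurableSet {ω' | ε < |ξ n k ω'|} := fun n k =>
    (((h n).adapted k).mono (ℱ.le (k + 1))).norm.measurable measurableSet_Ioi
  have hFi : ∀ n k, Integrable (F n k) P := fun n k =>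
    ((h n).memLp k).integrable_sq.indicator (hset n k)
  have hE : ∀ n k, MeasurableSet (varLE (s n) c k) := fun n k =>
    ℱ.le k _ ((h n).measurableSet_varLE c k)
  set U : ℕ → Ω → ℝ := fun n ω => ∑ k ∈ Finset.range n,
    (varLE (s n) c k).indicator (P[F n k | ℱ k]) ω with hU
  have hui : ∀ n k, Integrable ((varLE (s n) c k).indicator (P[F n k | ℱ k])) P := fun n k =>
    integrable_condExp.indicator (hE n k)
  have heq : ∀ n, ∑ k ∈ Finset.range n,
      ∫ ω, {ω | ε < |(varLE (s n) c k).indicator (ξ n k) ω|}.indicator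
        (fun ω => (varLE (s n) c k).indicator (ξ n k) ω ^ 2) ω ∂P = ∫ ω, U n ω ∂P := fun n => by
    rw [integral_finsetSum _ fun k _ => hui n k]
    refine Finset.sum_congr rfl fun k _ => ?_
    rw [integral_indicator (hE n k), setIntegral_condExp (ℱ.le k) (hFi n k)
      ((h n).measurableSet_varLE c k), ← integral_indicator (hE n k)]
    refine integral_congr_ae (ae_of_all _ fun ω => ?_)
    by_cases hω : ω ∈ varLE (s n) c k
    · simp [hF, Set.indicator, hω]
    · simp [Set.indicator, hω]
  have hnn : ∀ n k, 0 ≤ᵐ[P] P[F n k | ℱ k] := fun n k =>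
    condExp_nonneg (ae_of_all _ fun ω => Set.indicator_nonneg (fun _ _ => sq_nonneg _) ω)
  have hle : ∀ n k, P[F n k | ℱ k] ≤ᵐ[P] s n k := fun n k =>
    (condExp_mono (hFi n k) ((h n).memLp k).integrable_sq (ae_of_all _ fun ω =>
      Set.indicator_le_self' (fun _ _ => sq_nonneg _) ω)).trans ((h n).condVar k).le
  have hnn' : ∀ n, ∀ᵐ ω ∂P, ∀ k, 0 ≤ (P[F n k | ℱ k]) ω := fun n => ae_all_iff.2 (hnn n)
  have hle' : ∀ n, ∀ᵐ ω ∂P, ∀ k, (P[F n k | ℱ k]) ω ≤ s n k ω := fun n => ae_all_iff.2 (hle n)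
  simp_rw [heq]
  refine tendsto_integral_of_tendsto_measure (K := c)
    (fun n => (integrable_finsetSum _ fun k _ => hui n k).1) (fun n => ?_) (fun n => ?_) ?_
  · filter_upwards [hnn' n] with ω hω
    exact Finset.sum_nonneg fun k _ => Set.indicator_apply_nonneg fun _ => hω k
  · filter_upwards [hle' n] with ω hω
    exact (Finset.sum_le_sum fun k _ => Set.indicator_le_indicator (hω k)).trans
      (sum_indicator_varLE_le hc (s n) (h n).nonneg n ω)
  · intro δ hδ
    refine tendsto_of_tendsto_of_tendsto_of_le_of_le tendsto_const_nhds
      (tendstoInMeasure_iff_norm.1 hlind δ hδ) (fun _ => zero_le) fun n => ?_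
    refine measure_mono_ae ?_
    filter_upwards [hnn' n] with ω hω hω1
    have h1 : δ ≤ U n ω := hω1
    refine h1.trans ?_
    rw [sub_zero]
    exact (Finset.sum_le_sum fun k _ => Set.indicator_le_self' (fun _ _ => hω k) ω).trans
      (le_abs_self _)

/-- The martingale central limit theorem, conditional on the initial `σ`-algebra. -/
theorem IsMartingaleDiff.eventually_norm_integral_le {ξ s : ℕ → ℕ → Ω → ℝ}
    (h : ∀ n, IsMartingaleDiff P ℱ (ξ n) (s n)) {v : ℝ} (hv : 0 ≤ v)
    (hvar : TendstoInMeasure P (fun n ω => ∑ k ∈ Finset.range n, s n k ω) atTop (fun _ => v))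
    (hlind : ∀ ε : ℝ, 0 < ε → TendstoInMeasure P (fun n ω => ∑ k ∈ Finset.range n,
      (P[{ω' | ε < |ξ n k ω'|}.indicator (fun ω' => ξ n k ω' ^ 2) | ℱ k]) ω) atTop (fun _ => 0))
    (t : ℝ) {η : ℝ} (hη : 0 < η) :
    ∀ᶠ n in atTop, ∀ Y : Ω → ℂ, StronglyMeasurable[ℱ 0] Y → (∀ ω, ‖Y ω‖ ≤ 1) →
      ‖∫ ω, Y ω * (Complex.exp ((t * ∑ k ∈ Finset.range n, ξ n k ω : ℝ) * Complex.I)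
        - Real.exp (-(t ^ 2 * v / 2))) ∂P‖ ≤ η := by
  -- The margin `1` makes stopping inactive with probability tending to one: it has no effect as
  -- soon as the total conditional variance is within `1` of `v`.
  set c := v + 1 with hc
  have hc0 : 0 ≤ c := by linarith
  set ξ' : ℕ → ℕ → Ω → ℝ := fun n k => (varLE (s n) c k).indicator (ξ n k) with hξ'
  set s' : ℕ → ℕ → Ω → ℝ := fun n k => (varLE (s n) c k).indicator (s n k) with hs'
  have h' : ∀ n, IsMartingaleDiff P ℱ (ξ' n) (s' n) := fun n => (h n).truncate c
  have hA' : ∀ n m ω, ∑ k ∈ Finset.range m, s' n k ω ≤ c := fun n m ω =>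
    sum_indicator_varLE_le hc0 (s n) (h n).nonneg m ω
  have hsame : ∀ n ω, ∑ k ∈ Finset.range n, s n k ω ≤ c →
      ∑ k ∈ Finset.range n, s' n k ω = ∑ k ∈ Finset.range n, s n k ω ∧
      ∑ k ∈ Finset.range n, ξ' n k ω = ∑ k ∈ Finset.range n, ξ n k ω := fun n ω hω => by
    have hk : ∀ k ∈ Finset.range n, ω ∈ varLE (s n) c k := fun k hk =>
      mem_varLE_of_le (h n).nonneg hω (Finset.mem_range.1 hk)
    exact ⟨Finset.sum_congr rfl fun k hk' => Set.indicator_of_mem (hk k hk') _,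
      Finset.sum_congr rfl fun k hk' => Set.indicator_of_mem (hk k hk') _⟩
  set e : ℕ → Ω → ℂ := fun n ω =>
    Complex.exp ((t * ∑ k ∈ Finset.range n, ξ n k ω : ℝ) * Complex.I) with he
  set e' : ℕ → Ω → ℂ := fun n ω =>
    Complex.exp ((t * ∑ k ∈ Finset.range n, ξ' n k ω : ℝ) * Complex.I) with he'
  set a : ℕ → Ω → ℝ := fun n ω => Real.exp (t ^ 2 * (∑ k ∈ Finset.range n, s' n k ω) / 2) with ha
  set b : ℝ := Real.exp (t ^ 2 * v / 2) with hb
  have he1 : ∀ n ω, ‖e n ω‖ = 1 := fun n ω => Complex.norm_exp_ofReal_mul_I _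
  have he1' : ∀ n ω, ‖e' n ω‖ = 1 := fun n ω => Complex.norm_exp_ofReal_mul_I _
  have ha_le : ∀ n ω, a n ω ≤ Real.exp (t ^ 2 * c / 2) := fun n ω => by
    have := hA' n n ω
    exact Real.exp_le_exp.2 (by gcongr)
  have hb_le : b ≤ Real.exp (t ^ 2 * c / 2) :=
    Real.exp_le_exp.2 (by have : v ≤ c := by linarith
                          gcongr)
  have hem : ∀ n, AEStronglyMeasurable (e n) P := fun n => by
    have := (((h n).stronglyMeasurable_sum (le_refl n)).mono (ℱ.le n)).measurable
    exact Measurable.aestronglyMeasurable (by fun_prop)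
  have hem' : ∀ n, AEStronglyMeasurable (e' n) P := fun n => by
    have := (((h' n).stronglyMeasurable_sum (le_refl n)).mono (ℱ.le n)).measurable
    exact Measurable.aestronglyMeasurable (by fun_prop)
  have ham : ∀ n, Measurable (a n) := fun n => by
    have : Measurable fun ω => ∑ k ∈ Finset.range n, s' n k ω :=
      Finset.measurable_fun_sum _ fun j _ => (((h' n).predictable j).mono (ℱ.le j)).measurable
    fun_prop
  set U : ℕ → Ω → ℝ := fun n ω => ‖e n ω - e' n ω‖ + |b - a n ω| with hU
  have hU_le : ∀ n ω, U n ω ≤ 2 + Real.exp (t ^ 2 * c / 2) := fun n ω => by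
    have h1 := norm_sub_le (e n ω) (e' n ω)
    rw [he1, he1'] at h1
    have h2 : |b - a n ω| ≤ Real.exp (t ^ 2 * c / 2) := by
      have h3 : 0 ≤ a n ω := Real.exp_nonneg _
      have h4 : 0 ≤ b := Real.exp_nonneg _
      exact abs_le.2 ⟨by linarith [ha_le n ω], by linarith⟩
    simp only [hU]; linarith
  have hU0 : ∀ n ω, 0 ≤ U n ω := fun n ω => by positivity
  have hUm : ∀ n, AEStronglyMeasurable (U n) P := fun n =>
    ((hem n).sub (hem' n)).norm.add (measurable_const.sub (ham n)).norm.aestronglyMeasurable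
  have hUlim : Tendsto (fun n => ∫ ω, U n ω ∂P) atTop (𝓝 0) := by
    refine tendsto_integral_of_tendsto_measure hUm (fun n => ae_of_all _ (hU0 n))
      (fun n => ae_of_all _ (hU_le n)) fun δ hδ => ?_
    have hcont : Continuous fun x : ℝ => Real.exp (t ^ 2 * x / 2) := by fun_prop
    obtain ⟨r, hr, hr'⟩ := Metric.continuousAt_iff.1 (hcont.continuousAt (x := v)) δ hδ
    refine tendsto_of_tendsto_of_tendsto_of_le_of_le tendsto_const_nhds
      (tendstoInMeasure_iff_norm.1 hvar (min r 1) (lt_min hr one_pos)) (fun _ => zero_le)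
      fun n => measure_mono fun ω hω => ?_
    have hω' : δ ≤ U n ω := hω
    show min r 1 ≤ ‖_‖
    by_contra! hcon
    obtain ⟨h1, h2⟩ := lt_min_iff.1 hcon
    obtain ⟨h3, h4⟩ := hsame n ω (by rw [Real.norm_eq_abs, abs_lt] at h2; linarith)
    have h5 := hr' (x := ∑ k ∈ Finset.range n, s n k ω) (by rwa [dist_eq_norm])
    rw [dist_comm, Real.dist_eq] at h5
    have h6 : U n ω < δ := by
      simpa only [hU, he, he', ha, h3, h4, sub_self, norm_zero, zero_add] using h5
    linarith
  obtain ⟨ε, hε, hε0⟩ : ∃ ε : ℝ,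
      Real.exp (t ^ 2 * c / 2) * ((4 * |t| ^ 3 * ε + t ^ 4 / 4 * ε ^ 2) * c) < η / 3 ∧ 0 < ε := by
    have hcont : Continuous fun ε : ℝ =>
      Real.exp (t ^ 2 * c / 2) * ((4 * |t| ^ 3 * ε + t ^ 4 / 4 * ε ^ 2) * c) := by fun_prop
    have h0 : Real.exp (t ^ 2 * c / 2) * ((4 * |t| ^ 3 * 0 + t ^ 4 / 4 * 0 ^ 2) * c) < η / 3 := by
      simpa using hη
    have h1 := (hcont.tendsto 0).eventually (gt_mem_nhds h0)
    exact ((h1.filter_mono nhdsWithin_le_nhds).and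
      (self_mem_nhdsWithin (s := Set.Ioi (0 : ℝ)))).exists
  have hL := (IsMartingaleDiff.tendsto_sum_integral_truncate h hc0 (hlind ε hε0)).const_mul
    (Real.exp (t ^ 2 * c / 2) * (4 * t ^ 2 + t ^ 4 / 4 * c))
  rw [mul_zero] at hL
  filter_upwards [hUlim.eventually (gt_mem_nhds (by positivity : 0 < η / 3)),
    hL.eventually (gt_mem_nhds (by positivity : 0 < η / 3))] with n hn1 hn2 Y hY hY1
  have hmain := (h' n).norm_integral_exp_sub_one_le (hA' n) hε0.le hY hY1 t n
  have hYm : AEStronglyMeasurable Y P := (hY.mono (ℱ.le 0)).aestronglyMeasurable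
  have hUi : Integrable (U n) P := .of_bound (hUm n) _ (ae_of_all _ fun ω => by
    rw [Real.norm_of_nonneg (hU0 n ω)]; exact hU_le n ω)
  have hbinv : Real.exp (-(t ^ 2 * v / 2)) = b⁻¹ := Real.exp_neg _
  have hbpos : 0 < b := Real.exp_pos _
  have hb1 : b⁻¹ ≤ 1 := by
    rw [← hbinv]; exact Real.exp_le_one_iff.2 (by have : 0 ≤ t ^ 2 * v / 2 := by positivity
                                                  linarith)
  -- The splitting `e - b⁻¹ = (e - e') + b⁻¹ e' (b - a) + b⁻¹ (e' a - 1)`: the first two terms are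
  -- dominated by `U`, and the last is the estimate for the stopped martingale.
  set X1 : Ω → ℂ := fun ω => Y ω * ((e n ω - e' n ω) + (b : ℂ)⁻¹ * (e' n ω * (b - a n ω))) with hX1
  set X2 : Ω → ℂ := fun ω => Y ω * (e' n ω * a n ω - 1) with hX2
  have hX1b : ∀ ω, ‖X1 ω‖ ≤ U n ω := fun ω => by
    simp only [hX1]
    rw [norm_mul]
    refine (mul_le_of_le_one_left (norm_nonneg _) (hY1 ω)).trans ((norm_add_le _ _).trans ?_)
    simp only [hU]
    gcongr
    rw [norm_mul, norm_mul, he1', one_mul, ← Complex.ofReal_inv, ← Complex.ofReal_sub,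
      Complex.norm_real, Complex.norm_real, Real.norm_of_nonneg (inv_nonneg.2 hbpos.le)]
    exact mul_le_of_le_one_left (norm_nonneg _) hb1
  have hcam : AEStronglyMeasurable (fun ω => (a n ω : ℂ)) P :=
    (Complex.measurable_ofReal.comp (ham n)).aestronglyMeasurable
  have hX1i : Integrable X1 P := by
    refine hUi.mono' (hYm.mul (((hem n).sub (hem' n)).add (aestronglyMeasurable_const.mul
      ((hem' n).mul (aestronglyMeasurable_const.sub hcam))))) (ae_of_all _ hX1b)
  have hX2i : Integrable X2 P := by
    refine .of_bound (C := Real.exp (t ^ 2 * c / 2) + 1)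
      (hYm.mul (((hem' n).mul hcam).sub aestronglyMeasurable_const)) (ae_of_all _ fun ω => ?_)
    simp only [hX2]
    rw [norm_mul]
    refine (mul_le_of_le_one_left (norm_nonneg _) (hY1 ω)).trans ((norm_sub_le _ _).trans ?_)
    rw [norm_mul, he1', one_mul, norm_one, Complex.norm_real,
      Real.norm_of_nonneg (Real.exp_nonneg _)]
    linarith [ha_le n ω]
  have hsplit : ∫ ω, Y ω * (e n ω - (Real.exp (-(t ^ 2 * v / 2)) : ℝ)) ∂P =
      ∫ ω, X1 ω ∂P + (b : ℂ)⁻¹ * ∫ ω, X2 ω ∂P := by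
    rw [← integral_const_mul, ← integral_add hX1i (hX2i.const_mul _)]
    refine integral_congr_ae (ae_of_all _ fun ω => ?_)
    have hbne : (b : ℂ) ≠ 0 := by exact_mod_cast hbpos.ne'
    simp only [hX1, hX2, hbinv]
    push_cast
    field_simp
    ring
  have hn3 : ‖∫ ω, X1 ω ∂P‖ ≤ ∫ ω, U n ω ∂P :=
    norm_integral_le_of_norm_le hUi (ae_of_all _ hX1b)
  have hn4 : ‖(b : ℂ)⁻¹ * ∫ ω, X2 ω ∂P‖ ≤ ‖∫ ω, X2 ω ∂P‖ := by
    rw [norm_mul, ← Complex.ofReal_inv, Complex.norm_real,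
      Real.norm_of_nonneg (inv_nonneg.2 hbpos.le)]
    exact mul_le_of_le_one_left (norm_nonneg _) hb1
  have hn5 := norm_add_le (∫ ω, X1 ω ∂P) ((b : ℂ)⁻¹ * ∫ ω, X2 ω ∂P)
  have hn6 : ‖∫ ω, X2 ω ∂P‖ ≤ η / 3 + η / 3 := by
    refine hmain.trans ?_
    rw [mul_add, ← mul_assoc (Real.exp _) (4 * t ^ 2 + t ^ 4 / 4 * c)]
    exact add_le_add hε.le hn2.le
  rw [hsplit]
  linarith

end MartingaleCLT

/-! ### From characteristic functions to conditional laws. -/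

section CondLaw

/-- A second moment bound makes characteristic functions uniformly Lipschitz, as `|x| ≤ 1 + x²`;
values on a dense set then suffice. -/
lemma norm_charFun_sub_charFun_le {μ : Measure ℝ} [IsProbabilityMeasure μ] {K : ℝ}
    (hμ : Integrable (fun x : ℝ => x ^ 2) μ) (hK : ∫ x, x ^ 2 ∂μ ≤ K) (t s : ℝ) :
    ‖charFun μ t - charFun μ s‖ ≤ |t - s| * (1 + K) := by
  have hint : ∀ r : ℝ, Integrable (fun x : ℝ => Complex.exp (r * x * Complex.I)) μ := fun r =>
    .of_bound (C := 1) (Measurable.aestronglyMeasurable (by fun_prop)) (ae_of_all _ fun x => by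
      have := Complex.norm_exp_ofReal_mul_I (r * x)
      push_cast at this
      exact this.le)
  rw [charFun_apply_real, charFun_apply_real, ← integral_sub (hint t) (hint s)]
  have hpt : ∀ x : ℝ, ‖Complex.exp (t * x * Complex.I) - Complex.exp (s * x * Complex.I)‖ ≤
      |t - s| * (1 + x ^ 2) := fun x => by
    have e : Complex.exp (t * x * Complex.I) - Complex.exp (s * x * Complex.I) =
        Complex.exp ((s * x : ℝ) * Complex.I) *
          (Complex.exp (Complex.I * ((t - s) * x : ℝ)) - 1) := by
      rw [mul_sub, mul_one, ← Complex.exp_add]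
      push_cast
      congr 2
      ring
    rw [e, norm_mul, Complex.norm_exp_ofReal_mul_I, one_mul]
    refine Real.norm_exp_I_mul_ofReal_sub_one_le.trans ?_
    rw [norm_mul, Real.norm_eq_abs, Real.norm_eq_abs]
    gcongr
    nlinarith [sq_abs x, sq_nonneg (|x| - 1)]
  refine (norm_integral_le_of_norm_le (((integrable_const 1).add hμ).const_mul _)
    (ae_of_all _ hpt)).trans ?_
  simp only [Pi.add_apply]
  rw [integral_const_mul, integral_add (integrable_const 1) hμ]
  simp only [integral_const, probReal_univ, smul_eq_mul, mul_one]
  gcongr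

/-- Among probability measures with a fixed bound on the second moment, finitely many values of the
characteristic function control the Lévy–Prokhorov distance to a given measure. -/
lemma exists_finset_charFun_dist_lt (G : ProbabilityMeasure ℝ) (K : ℝ) {ε : ℝ} (hε : 0 < ε) :
    ∃ (T : Finset ℝ) (δ : ℝ), 0 < δ ∧ ∀ μ : ProbabilityMeasure ℝ,
      Integrable (fun x : ℝ => x ^ 2) (μ : Measure ℝ) → ∫ x, x ^ 2 ∂(μ : Measure ℝ) ≤ K →
      (∀ t ∈ T, ‖charFun (μ : Measure ℝ) t - charFun (G : Measure ℝ) t‖ < δ) →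
      dist (LevyProkhorov.ofMeasure μ) (LevyProkhorov.ofMeasure G) < ε := by
  -- Otherwise for each `j` some measure stays `ε` away from `G` although its characteristic
  -- function is within `1 / (j + 1)` of that of `G` at the first `j` points of a dense sequence.
  -- The common Lipschitz bound extends convergence to every `t`, and Lévy's continuity theorem
  -- gives a contradiction.
  by_contra! hcon
  choose μ hμi hμK hμT hμd using fun j : ℕ =>
    hcon ((Finset.range j).image (TopologicalSpace.denseSeq ℝ)) (1 / ((j : ℝ) + 1)) (by positivity)
  have hlim : Tendsto μ atTop (𝓝 G) := by
    refine ProbabilityMeasure.tendsto_of_tendsto_charFun fun t => ?_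
    rw [Metric.tendsto_atTop]
    intro η hη
    obtain ⟨i, hi1, hi2⟩ : ∃ i, |t - TopologicalSpace.denseSeq ℝ i| * (1 + K) < η / 3 ∧
        ‖charFun (G : Measure ℝ) (TopologicalSpace.denseSeq ℝ i) - charFun (G : Measure ℝ) t‖
          < η / 3 := by
      have h1 : ∀ᶠ s in 𝓝 t, |t - s| * (1 + K) < η / 3 := by
        have hc : Continuous fun s : ℝ => |t - s| * (1 + K) := by fun_prop
        refine (hc.tendsto t).eventually (gt_mem_nhds ?_)
        simpa using hη
      have h2 : ∀ᶠ s in 𝓝 t, ‖charFun (G : Measure ℝ) s - charFun (G : Measure ℝ) t‖ < η / 3 := by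
        have hc : Continuous fun s : ℝ => ‖charFun (G : Measure ℝ) s - charFun (G : Measure ℝ) t‖ := by
          fun_prop
        refine (hc.tendsto t).eventually (gt_mem_nhds ?_)
        simpa using hη
      obtain ⟨U, hU, hUo, htU⟩ := eventually_nhds_iff.1 (h1.and h2)
      obtain ⟨i, hi⟩ := (TopologicalSpace.denseRange_denseSeq ℝ).exists_mem_open hUo ⟨t, htU⟩
      exact ⟨i, hU _ hi⟩
    obtain ⟨N, hN⟩ := exists_nat_one_div_lt (by positivity : 0 < η / 3)
    refine ⟨max N (i + 1), fun j hj => ?_⟩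
    have hjN : N ≤ j := (le_max_left _ _).trans hj
    have hji : i + 1 ≤ j := (le_max_right _ _).trans hj
    have h1 := norm_charFun_sub_charFun_le (hμi j) (hμK j) t (TopologicalSpace.denseSeq ℝ i)
    have h2 := hμT j (TopologicalSpace.denseSeq ℝ i)
      (Finset.mem_image_of_mem _ (Finset.mem_range.2 hji))
    have h3 : 1 / ((j : ℝ) + 1) ≤ 1 / ((N : ℝ) + 1) := by gcongr
    rw [dist_eq_norm]
    calc ‖charFun (μ j : Measure ℝ) t - charFun (G : Measure ℝ) t‖
        = ‖(charFun (μ j : Measure ℝ) t - charFun (μ j : Measure ℝ) (TopologicalSpace.denseSeq ℝ i))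
          + (charFun (μ j : Measure ℝ) (TopologicalSpace.denseSeq ℝ i)
            - charFun (G : Measure ℝ) (TopologicalSpace.denseSeq ℝ i))
          + (charFun (G : Measure ℝ) (TopologicalSpace.denseSeq ℝ i)
            - charFun (G : Measure ℝ) t)‖ := by congr 1; ring
      _ ≤ _ := norm_add₃_le
      _ < η := by linarith
  have h1 := ((LevyProkhorov.continuous_ofMeasure_probabilityMeasure (Ω := ℝ)).tendsto G).comp hlim
  obtain ⟨N, hN⟩ := Metric.tendsto_atTop.1 h1 ε hε
  exact (hN N le_rfl).not_ge (hμd N)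

variable {Ω S : Type*} [m0 : MeasurableSpace Ω] [mS : MeasurableSpace S] {P : Measure Ω}
  [IsProbabilityMeasure P]

/-- The conditional characteristic function is the conditional expectation of `exp(i t Z)`, so the
duality bound `integral_norm_condExp_le` applies. -/
lemma integral_norm_charFun_condDistrib_sub_le {Z : Ω → ℝ} (hZ : AEMeasurable Z P) {Y : Ω → S}
    (hY : Measurable Y) (t : ℝ) (a : ℂ) {η : ℝ}
    (h : ∀ X : Ω → ℂ, StronglyMeasurable[mS.comap Y] X → (∀ ω, ‖X ω‖ ≤ 1) →
      ‖∫ ω, X ω * (Complex.exp ((t * Z ω : ℝ) * Complex.I) - a) ∂P‖ ≤ η) :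
    Integrable (fun ω => ‖charFun (condDistrib Z Y P (Y ω)) t - a‖) P ∧
      ∫ ω, ‖charFun (condDistrib Z Y P (Y ω)) t - a‖ ∂P ≤ η := by
  have hm : Measurable fun x : ℝ => Complex.exp ((t * x : ℝ) * Complex.I) := by fun_prop
  have hi : Integrable (fun ω => Complex.exp ((t * Z ω : ℝ) * Complex.I)) P :=
    .of_bound (C := 1) (hm.comp_aemeasurable hZ).aestronglyMeasurable
      (ae_of_all _ fun ω => (Complex.norm_exp_ofReal_mul_I _).le)
  have h1 := condExp_ae_eq_integral_condDistrib hY hZ hm.stronglyMeasurable hi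
  have h2 : P[fun ω => Complex.exp ((t * Z ω : ℝ) * Complex.I) - a | mS.comap Y] =ᵐ[P]
      fun ω => charFun (condDistrib Z Y P (Y ω)) t - a := by
    refine (condExp_sub hi (integrable_const a) _).trans ?_
    filter_upwards [h1] with ω hω
    rw [Pi.sub_apply, hω, condExp_const hY.comap_le, charFun_apply_real]
    simp
  have h3 : (fun ω => ‖(P[fun ω => Complex.exp ((t * Z ω : ℝ) * Complex.I) - a | mS.comap Y]) ω‖)
      =ᵐ[P] fun ω => ‖charFun (condDistrib Z Y P (Y ω)) t - a‖ := h2.fun_comp norm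
  refine ⟨integrable_condExp.norm.congr h3, ?_⟩
  rw [← integral_congr_ae h3]
  exact integral_norm_condExp_le hY.comap_le (hi.sub (integrable_const a)) h

/-- Conditional laws converge in probability as soon as their characteristic functions converge in
mean and the second moments are bounded. -/
theorem tendstoCondLaw_of_charFun {Z : ℕ → Ω → ℝ} (hZ : ∀ n, MemLp (Z n) 2 P) {Y : Ω → S}
    (hY : Measurable Y) {C : ℝ} (hC : ∀ n, ∫ ω, Z n ω ^ 2 ∂P ≤ C) (G : ProbabilityMeasure ℝ)
    (h : ∀ (t : ℝ) (η : ℝ), 0 < η → ∀ᶠ n in atTop, ∀ X : Ω → ℂ,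
      StronglyMeasurable[mS.comap Y] X → (∀ ω, ‖X ω‖ ≤ 1) →
      ‖∫ ω, X ω * (Complex.exp ((t * Z n ω : ℝ) * Complex.I) - charFun (G : Measure ℝ) t) ∂P‖ ≤ η) :
    TendstoCondLaw P Z Y G := by
  have hZm : ∀ n, AEMeasurable (Z n) P := fun n => (hZ n).1.aemeasurable
  refine tendstoInMeasure_iff_measureReal_dist.2 fun ε hε => ?_
  refine tendsto_order.2 ⟨fun a ha => Eventually.of_forall fun n => ha.trans_le measureReal_nonneg,
    fun ρ hρ => ?_⟩
  have hC0 : 0 ≤ C := (integral_nonneg fun ω => sq_nonneg (Z 0 ω)).trans (hC 0)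
  -- By Markov's inequality the conditional second moment exceeds `K` with probability at most `ρ /
  -- 2`. The choice of `η` below leaves at most `ρ / 4` for all of `T` together.
  set K : ℝ := 2 * (C + 1) / ρ with hKdef
  have hK : 0 < K := by positivity
  obtain ⟨T, δ, hδ, hT⟩ := exists_finset_charFun_dist_lt G K hε
  set η : ℝ := δ * ρ / (4 * (T.card + 1)) with hη
  have hη0 : 0 < η := by positivity
  have hall : ∀ᶠ n in atTop, ∀ t ∈ T, ∀ X : Ω → ℂ,
      StronglyMeasurable[mS.comap Y] X → (∀ ω, ‖X ω‖ ≤ 1) →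
      ‖∫ ω, X ω * (Complex.exp ((t * Z n ω : ℝ) * Complex.I) - charFun (G : Measure ℝ) t) ∂P‖ ≤ η :=
    (Finset.eventually_all T).2 fun t _ => h t η hη0
  filter_upwards [hall] with n hn
  have hsq := condExp_ae_eq_integral_condDistrib hY (hZm n)
    (f := fun x : ℝ => x ^ 2) (by fun_prop) (hZ n).integrable_sq
  have hmom : P.real {ω | K ≤ ∫ x, x ^ 2 ∂(condDistrib (Z n) Y P (Y ω))} ≤ ρ / 2 := by
    have h1 := mul_meas_ge_le_integral_of_nonneg (μ := P)
      (f := fun ω => ∫ x, x ^ 2 ∂(condDistrib (Z n) Y P (Y ω)))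
      (ae_of_all _ fun ω => integral_nonneg fun x => sq_nonneg x)
      (integrable_condExp.congr hsq) K
    rw [← integral_congr_ae hsq, integral_condExp hY.comap_le] at h1
    have h2 := h1.trans (hC n)
    have h3 : K * (ρ / 2) = C + 1 := by rw [hKdef]; field_simp
    nlinarith
  have hchar : ∀ t ∈ T, P.real {ω | δ ≤ ‖charFun (condDistrib (Z n) Y P (Y ω)) t
      - charFun (G : Measure ℝ) t‖} ≤ ρ / (4 * (T.card + 1)) := fun t ht => by
    obtain ⟨h1, h2⟩ := integral_norm_charFun_condDistrib_sub_le (hZm n) hY t _ (hn t ht)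
    have h3 := (mul_meas_ge_le_integral_of_nonneg (ae_of_all _ fun ω => norm_nonneg _) h1 δ).trans h2
    have h4 : η = δ * (ρ / (4 * (T.card + 1))) := by rw [hη]; ring
    rw [h4] at h3
    exact le_of_mul_le_mul_left h3 hδ
  have hint : ∀ᵐ ω ∂P, Integrable (fun x : ℝ => x ^ 2) (condDistrib (Z n) Y P (Y ω)) := by
    have h1 : Integrable (fun p : S × ℝ => p.2 ^ 2) (P.map fun ω => (Y ω, Z n ω)) := by
      rw [integrable_map_measure (by fun_prop) (hY.aemeasurable.prodMk (hZm n))]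
      exact (hZ n).integrable_sq
    exact h1.condDistrib_ae hY.aemeasurable (hZm n)
  have hsub : P.real {ω | ε ≤ dist (condLaw P (Z n) Y ω) (LevyProkhorov.ofMeasure G)} ≤
      P.real ({ω | K ≤ ∫ x, x ^ 2 ∂(condDistrib (Z n) Y P (Y ω))} ∪
        ⋃ t ∈ T, {ω | δ ≤ ‖charFun (condDistrib (Z n) Y P (Y ω)) t
          - charFun (G : Measure ℝ) t‖}) := by
    refine ENNReal.toReal_mono (measure_ne_top _ _) (measure_mono_ae ?_)
    filter_upwards [hint] with ω hω hω1
    by_contra hcon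
    have hcon' : ω ∉ ({ω | K ≤ ∫ x, x ^ 2 ∂(condDistrib (Z n) Y P (Y ω))} ∪
        ⋃ t ∈ T, {ω | δ ≤ ‖charFun (condDistrib (Z n) Y P (Y ω)) t
          - charFun (G : Measure ℝ) t‖}) := hcon
    simp only [Set.mem_union, Set.mem_iUnion, Set.mem_ofPred_eq, not_or, not_exists, not_le]
      at hcon'
    have h1 := hT ⟨condDistrib (Z n) Y P (Y ω), inferInstance⟩ hω hcon'.1.le
      fun t ht => hcon'.2 t ht
    exact h1.not_ge hω1
  refine (hsub.trans (measureReal_union_le _ _)).trans_lt ?_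
  have h1 : P.real (⋃ t ∈ T, {ω | δ ≤ ‖charFun (condDistrib (Z n) Y P (Y ω)) t
      - charFun (G : Measure ℝ) t‖}) ≤ ρ / 4 := by
    refine (measureReal_biUnion_finset_le _ _).trans ((Finset.sum_le_card_nsmul _ _ _ hchar).trans ?_)
    rw [nsmul_eq_mul, mul_div_assoc', div_le_div_iff₀ (by positivity) (by positivity)]
    nlinarith
  linarith

end CondLaw

/-! ### The transition operator on `L²(π)`. -/

section TransOp

variable {S : Type*} [mS : MeasurableSpace S] {π : Measure S} {Q : Kernel S S}

/-- Invariance of `π` makes a `π`-null set `Q w`-null for almost every `w`; hence the operator acts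
on classes of functions. -/
lemma transOp_congr (hinv : Q.Invariant π) {f h : S → ℝ} (hfh : f =ᵐ[π] h) :
    transOp Q f =ᵐ[π] transOp Q h := by
  have h1 : f =ᵐ[Q ∘ₘ π] h := by rw [hinv]; exact hfh
  filter_upwards [Measure.ae_ae_of_ae_comp h1] with w hw using integral_congr_ae hw

lemma aestronglyMeasurable_transOp (hinv : Q.Invariant π) {f : S → ℝ}
    (hf : AEStronglyMeasurable f π) : AEStronglyMeasurable (transOp Q f) π :=
  ⟨transOp Q (hf.mk f), hf.stronglyMeasurable_mk.integral_kernel, transOp_congr hinv hf.ae_eq_mk⟩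

lemma ae_integrable_kernel (hinv : Q.Invariant π) {f : S → ℝ} (hf : Integrable f π) :
    ∀ᵐ w ∂π, Integrable f (Q w) :=
  Measure.ae_integrable_of_integrable_comp (by rwa [hinv])

/-- Jensen's inequality under each `Q w`, followed by integration against the invariant `π`. -/
lemma eLpNorm_transOp_le [IsMarkovKernel Q] (hinv : Q.Invariant π) {f : S → ℝ}
    (hf : AEStronglyMeasurable f π) : eLpNorm (transOp Q f) 2 π ≤ eLpNorm f 2 π := by
  have hsq : ∀ (μ : Measure S) (h : S → ℝ), eLpNorm h 2 μ ^ 2 = ∫⁻ w, ‖h w‖ₑ ^ 2 ∂μ := fun μ h => by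
    have := eLpNorm_nnreal_pow_eq_lintegral (f := h) (μ := μ) (p := 2) two_ne_zero
    simpa using this
  have hae : ∀ᵐ w ∂π, f =ᵐ[Q w] hf.mk f :=
    Measure.ae_ae_of_ae_comp (by rw [hinv]; exact hf.ae_eq_mk)
  have hpt : ∀ᵐ w ∂π, ‖transOp Q f w‖ₑ ^ 2 ≤ ∫⁻ z, ‖f z‖ₑ ^ 2 ∂(Q w) := by
    filter_upwards [hae] with w hw
    rw [← hsq]
    gcongr
    refine (enorm_integral_le_lintegral_enorm _).trans ?_
    rw [← eLpNorm_one_eq_lintegral_enorm]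
    exact eLpNorm_le_eLpNorm_of_exponent_le (by norm_num) ⟨_, hf.stronglyMeasurable_mk, hw⟩
  have h1 : eLpNorm (transOp Q f) 2 π ^ 2 ≤ eLpNorm f 2 π ^ 2 := by
    rw [hsq, hsq π f]
    refine (lintegral_mono_ae hpt).trans_eq ?_
    conv_rhs => rw [← (show Q ∘ₘ π = π from hinv)]
    rw [Measure.lintegral_bind Q.aemeasurable]
    rw [hinv]
    exact hf.enorm.pow_const 2
  exact (ENNReal.pow_le_pow_left_iff two_ne_zero).1 h1

lemma memLp_transOp [IsMarkovKernel Q] (hinv : Q.Invariant π) {f : S → ℝ}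
    (hf : MemLp f 2 π) : MemLp (transOp Q f) 2 π :=
  ⟨aestronglyMeasurable_transOp hinv hf.1, (eLpNorm_transOp_le hinv hf.1).trans_lt hf.2⟩

lemma map_swap_compProd [IsFiniteMeasure π] [IsMarkovKernel Q] (hrev : Q.IsReversible π) :
    (π ⊗ₘ Q).map Prod.swap = π ⊗ₘ Q := by
  refine Measure.ext_prod fun {s t} hs ht => ?_
  rw [Measure.map_apply measurable_swap (hs.prod ht), Set.preimage_swap_prod,
    Measure.compProd_apply_prod ht hs, Measure.compProd_apply_prod hs ht]
  exact hrev ht hs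

/-- Both sides are integrals against the law `π ⊗ₘ Q` of two consecutive states, which reversibility
makes invariant under exchange of coordinates. -/
lemma integral_mul_transOp [IsFiniteMeasure π] [IsMarkovKernel Q] (hrev : Q.IsReversible π)
    {f h : S → ℝ} (hf : MemLp f 2 π) (hh : MemLp h 2 π) :
    ∫ w, f w * transOp Q h w ∂π = ∫ w, transOp Q f w * h w ∂π := by
  have hfst : MeasurePreserving Prod.fst (π ⊗ₘ Q) π := ⟨measurable_fst, Measure.fst_compProd π Q⟩
  have hsnd : MeasurePreserving Prod.snd (π ⊗ₘ Q) π :=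
    ⟨measurable_snd, (Measure.snd_compProd π Q).trans hrev.invariant⟩
  have key : ∀ {f h : S → ℝ}, MemLp f 2 π → MemLp h 2 π →
      ∫ w, f w * transOp Q h w ∂π = ∫ p, f p.1 * h p.2 ∂(π ⊗ₘ Q) := fun hf hh => by
    rw [Measure.integral_compProd (f := fun p => _ * _)
      ((hf.comp_measurePreserving hfst).integrable_mul (hh.comp_measurePreserving hsnd))]
    refine integral_congr_ae (ae_of_all _ fun w => ?_)
    simp only [transOp, integral_const_mul]
  rw [key hf hh, ← map_swap_compProd hrev, integral_map measurable_swap.aemeasurable]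
  · simp_rw [mul_comm (transOp Q f _)]
    rw [key hh hf]
    refine integral_congr_ae (ae_of_all _ fun p => ?_)
    simp [mul_comm]
  · rw [map_swap_compProd hrev]
    exact ((hf.comp_measurePreserving hfst).integrable_mul (hh.comp_measurePreserving hsnd)).1

/-- The transition operator on `L²` of an invariant probability measure. -/
noncomputable def transLp [IsFiniteMeasure π] [IsMarkovKernel Q] (hinv : Q.Invariant π) :
    Lp ℝ 2 π →ₗ[ℝ] Lp ℝ 2 π where
  toFun f := (memLp_transOp hinv (Lp.memLp f)).toLp _
  map_add' f h := by
    rw [← MemLp.toLp_add, MemLp.toLp_eq_toLp_iff]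
    refine (transOp_congr hinv (Lp.coeFn_add f h)).trans ?_
    filter_upwards [ae_integrable_kernel hinv ((Lp.memLp f).integrable (by norm_num)),
      ae_integrable_kernel hinv ((Lp.memLp h).integrable (by norm_num))] with w h1 h2
    exact integral_add h1 h2
  map_smul' a f := by
    rw [RingHom.id_apply, ← MemLp.toLp_const_smul, MemLp.toLp_eq_toLp_iff]
    refine (transOp_congr hinv (Lp.coeFn_smul a f)).trans (ae_of_all _ fun w => ?_)
    exact integral_const_mul a _

variable [IsFiniteMeasure π] [IsMarkovKernel Q]

lemma coeFn_transLp (hinv : Q.Invariant π) {f : S → ℝ} {x : Lp ℝ 2 π} (h : f =ᵐ[π] x) :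
    transOp Q f =ᵐ[π] transLp hinv x :=
  (transOp_congr hinv h).trans (MemLp.coeFn_toLp (memLp_transOp hinv (Lp.memLp x))).symm

lemma norm_transLp_le (hinv : Q.Invariant π) (x : Lp ℝ 2 π) : ‖transLp hinv x‖ ≤ ‖x‖ := by
  rw [transLp, LinearMap.coe_mk, AddHom.coe_mk, Lp.norm_toLp, Lp.norm_def]
  exact ENNReal.toReal_mono (Lp.eLpNorm_ne_top x) (eLpNorm_transOp_le hinv (Lp.memLp x).1)

lemma inner_eq_integral_mul {α : Type*} [MeasurableSpace α] {μ : Measure α} {x y : Lp ℝ 2 μ}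
    {f h : α → ℝ} (hf : f =ᵐ[μ] x) (hh : h =ᵐ[μ] y) : inner ℝ x y = ∫ a, f a * h a ∂μ := by
  rw [L2.inner_def]
  refine integral_congr_ae ?_
  filter_upwards [hf, hh] with a h1 h2
  rw [h1, h2]
  simp [mul_comm]

lemma isSymmetric_transLp (hrev : Q.IsReversible π) :
    (transLp hrev.invariant).IsSymmetric := fun x y => by
  rw [inner_eq_integral_mul (coeFn_transLp hrev.invariant (EventuallyEq.refl _ x))
      (EventuallyEq.refl _ y),
    inner_eq_integral_mul (EventuallyEq.refl _ x)
      (coeFn_transLp hrev.invariant (EventuallyEq.refl _ y)),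
    integral_mul_transOp hrev (Lp.memLp x) (Lp.memLp y)]

lemma coeFn_transLp_pow (hinv : Q.Invariant π) {g : S → ℝ} {x : Lp ℝ 2 π} (h : g =ᵐ[π] x)
    (k : ℕ) : (transOp Q)^[k] g =ᵐ[π] (transLp hinv ^ k) x := by
  induction k with
  | zero => simpa using h
  | succ k ih =>
    rw [Function.iterate_succ_apply', pow_succ', Module.End.mul_apply]
    exact coeFn_transLp hinv ih

lemma coeFn_finsetSum_of_ae_eq {α ι : Type*} [MeasurableSpace α] {μ : Measure α} (s : Finset ι)
    {f : ι → α → ℝ} {x : ι → Lp ℝ 2 μ} (h : ∀ i ∈ s, f i =ᵐ[μ] x i) :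
    (fun a => ∑ i ∈ s, f i a) =ᵐ[μ] (∑ i ∈ s, x i : Lp ℝ 2 μ) := by
  classical
  induction s using Finset.induction_on with
  | empty => simpa using! (Lp.coeFn_zero ℝ 2 μ).symm
  | insert i s hi ih =>
    rw [Finset.sum_insert hi]
    filter_upwards [ih fun j hj => h j (Finset.mem_insert_of_mem hj),
      h i (Finset.mem_insert_self i s), Lp.coeFn_add (x i) (∑ i ∈ s, x i)] with a h1 h2 h3
    rw [Finset.sum_insert hi, h3, Pi.add_apply, h1, h2]

lemma coeFn_V (hinv : Q.Invariant π) {g : S → ℝ} {x : Lp ℝ 2 π} (h : g =ᵐ[π] x) (n : ℕ) :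
    V Q g n =ᵐ[π] (powSum (transLp hinv) x n : Lp ℝ 2 π) :=
  coeFn_finsetSum_of_ae_eq _ fun k _ => coeFn_transLp_pow hinv h k

/-- The averages of the partial sums of the orbit of `x`. -/
noncomputable def powSumAvg {H : Type*} [NormedAddCommGroup H] [InnerProductSpace ℝ H]
    (T : H →ₗ[ℝ] H) (x : H) (n : ℕ) : H :=
  (n : ℝ)⁻¹ • ∑ j ∈ Finset.Icc 1 n, powSum T x j

lemma coeFn_Vbar (hinv : Q.Invariant π) {g : S → ℝ} {x : Lp ℝ 2 π} (h : g =ᵐ[π] x) (n : ℕ) :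
    Vbar Q g n =ᵐ[π] (powSumAvg (transLp hinv) x n : Lp ℝ 2 π) := by
  filter_upwards [coeFn_finsetSum_of_ae_eq (Finset.Icc 1 n) fun j _ => coeFn_V hinv h j,
    Lp.coeFn_smul (n : ℝ)⁻¹ (∑ j ∈ Finset.Icc 1 n, powSum (transLp hinv) x j)] with w h1 h2
  rw [powSumAvg, h2, Pi.smul_apply, ← h1, smul_eq_mul, Vbar, div_eq_inv_mul]

end TransOp

/-! ### Martingale approximation in Hilbert space. -/

section Approximation

variable {H K : Type*} [NormedAddCommGroup H] [InnerProductSpace ℝ H] [NormedAddCommGroup K]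
  [InnerProductSpace ℝ K] {T : H →ₗ[ℝ] H}

/-- The average over `1 ≤ j ≤ n` of `V_j x - T V_j x = x - T^j x`. -/
lemma powSumAvg_sub_map (x : H) {n : ℕ} (hn : n ≠ 0) :
    powSumAvg T x n - T (powSumAvg T x n) = x - (n : ℝ)⁻¹ • T (powSum T x n) := by
  have h1 : ∑ j ∈ Finset.Icc 1 n, (T ^ j) x = T (powSum T x n) := by
    rw [powSum, map_sum]
    clear hn
    induction n with
    | zero => simp
    | succ n ih =>
      rw [Finset.sum_Icc_succ_top (by omega), Finset.sum_range_succ, ih,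
        ← Module.End.mul_apply, ← pow_succ']
  have hn' : (n : ℝ) ≠ 0 := by exact_mod_cast hn
  rw [powSumAvg, map_smul, ← smul_sub, map_sum, ← Finset.sum_sub_distrib]
  simp_rw [powSum_sub_map]
  rw [Finset.sum_sub_distrib, h1, Finset.sum_const, Nat.card_Icc, smul_sub, add_tsub_cancel_right,
    ← Nat.cast_smul_eq_nsmul ℝ, smul_smul, inv_mul_cancel₀ hn', one_smul]

lemma norm_powSumAvg_le (x : H) {n : ℕ} {B : ℝ} (hB0 : 0 ≤ B)
    (hB : ∀ j ≤ n, ‖powSum T x j‖ ≤ B) : ‖powSumAvg T x n‖ ≤ B := by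
  rcases eq_or_ne n 0 with rfl | hn
  · simpa [powSumAvg] using hB0
  have hn' : (0 : ℝ) < n := by exact_mod_cast Nat.pos_of_ne_zero hn
  rw [powSumAvg, norm_smul, norm_inv, Real.norm_natCast, inv_mul_le_iff₀ hn']
  refine (norm_sum_le _ _).trans ((Finset.sum_le_card_nsmul _ _ B fun j hj =>
    hB j (Finset.mem_Icc.1 hj).2).trans_eq ?_)
  rw [Nat.card_Icc, nsmul_eq_mul, add_tsub_cancel_right]

/-- The distance of a stationary partial sum from its martingale approximation. -/
lemma norm_sum_sub_martingale_le (hc : ∀ x, ‖T x‖ ≤ ‖x‖) (J : ℕ → H →ₗᵢ[ℝ] K) (x : H) (n : ℕ)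
    {B : ℝ} (hB : ∀ j ≤ n, ‖powSum T x j‖ ≤ B) :
    ‖∑ k ∈ Finset.range n, J (k + 1) x -
      ∑ k ∈ Finset.range n, (J (k + 1) (powSumAvg T x n) - J k (T (powSumAvg T x n)))‖ ≤ 3 * B := by
  have hB0 : 0 ≤ B := (norm_nonneg _).trans (hB 0 (Nat.zero_le n))
  rcases eq_or_ne n 0 with rfl | hn
  · simpa using hB0
  have hn' : (0 : ℝ) < n := by exact_mod_cast Nat.pos_of_ne_zero hn
  set h := powSumAvg T x n with hh
  have hx : x = h - T h + (n : ℝ)⁻¹ • T (powSum T x n) := by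
    rw [hh, powSumAvg_sub_map x hn, sub_add_cancel]
  -- The terms `J k (T h)` telescope to two boundary terms, of norm at most `2 B` together; the
  -- other `n` terms have norm at most `B / n` each.
  have e : ∑ k ∈ Finset.range n, J (k + 1) x -
      ∑ k ∈ Finset.range n, (J (k + 1) h - J k (T h)) =
      (J 0 (T h) - J n (T h)) +
        ∑ k ∈ Finset.range n, J (k + 1) ((n : ℝ)⁻¹ • T (powSum T x n)) := by
    rw [← Finset.sum_range_sub' (fun k => J k (T h)), ← Finset.sum_sub_distrib,
      ← Finset.sum_add_distrib]
    refine Finset.sum_congr rfl fun k _ => ?_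
    conv_lhs => rw [hx, map_add, map_sub]
    abel
  rw [e]
  have h1 : ‖h‖ ≤ B := norm_powSumAvg_le x hB0 hB
  have h2 : ‖J 0 (T h) - J n (T h)‖ ≤ 2 * B := by
    refine (norm_sub_le _ _).trans ?_
    rw [LinearIsometry.norm_map, LinearIsometry.norm_map]
    linarith [hc h]
  have h3 : ‖∑ k ∈ Finset.range n, J (k + 1) ((n : ℝ)⁻¹ • T (powSum T x n))‖ ≤ B := by
    refine (norm_sum_le _ _).trans ?_
    simp_rw [LinearIsometry.norm_map]
    rw [Finset.sum_const, Finset.card_range, nsmul_eq_mul, norm_smul, norm_inv, Real.norm_natCast,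
      mul_inv_cancel_left₀ hn'.ne']
    exact (hc _).trans (hB n le_rfl)
  exact (norm_add_le _ _).trans (by linarith)

/-- Adding one term contributes its own variance and twice its covariance with each earlier term,
which depends on the lag only. -/
lemma norm_sum_sq_eq_varSeq (J : ℕ → H →ₗᵢ[ℝ] K) (x : H)
    (hJ : ∀ i m, inner ℝ (J i x) (J (i + m) x) = (inner ℝ x ((T ^ m) x) : ℝ)) (n : ℕ) :
    ‖∑ k ∈ Finset.range n, J (k + 1) x‖ ^ 2 = varSeq (fun k => inner ℝ x ((T ^ k) x)) n := by
  induction n with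
  | zero => simp [varSeq]
  | succ n ih =>
    have h1 : inner ℝ (∑ k ∈ Finset.range n, J (k + 1) x) (J (n + 1) x) =
        ∑ k ∈ Finset.range n, (inner ℝ x ((T ^ (k + 1)) x) : ℝ) := by
      rw [sum_inner, ← Finset.sum_range_reflect (fun k => (inner ℝ (J (k + 1) x) (J (n + 1) x) : ℝ))]
      refine Finset.sum_congr rfl fun k hk => ?_
      have := Finset.mem_range.1 hk
      rw [← hJ (n - 1 - k + 1) (k + 1),
        show n - 1 - k + 1 + (k + 1) = n + 1 by omega]
    have h2 := hJ (n + 1) 0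
    rw [add_zero, real_inner_self_eq_norm_sq] at h2
    rw [Finset.sum_range_succ, norm_add_sq_real, ih, h1, h2, varSeq, varSeq,
      Finset.sum_range_succ, Finset.sum_range_succ' _ n]
    ring

end Approximation

/-! ### The Markov property and martingale differences along the chain. -/

section Markov

variable {Ω S : Type*} [mΩ : MeasurableSpace Ω] [mS : MeasurableSpace S] {P : Measure Ω}
  [IsProbabilityMeasure P] {W : ℤ → Ω → S} {Q : Kernel S S} [IsMarkovKernel Q] {π : Measure S}

/-- If `Q` evaluated at `w (X)` gives the conditional probabilities of `Y` given `X`, then it also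
gives conditional expectations. -/
lemma condExp_eq_integral_of_condProb [StandardBorelSpace S] [Nonempty S] {β : Type*}
    [mβ : MeasurableSpace β] {X : Ω → β} (hX : Measurable X) {w : β → S} (hw : Measurable w)
    {Y : Ω → S} (hY : Measurable Y)
    (hprob : ∀ B, MeasurableSet B → P[(Y ⁻¹' B).indicator (fun _ => (1 : ℝ)) | mβ.comap X]
      =ᵐ[P] fun ω => (Q (w (X ω))).real B)
    {F : S × S → ℝ} (hF : StronglyMeasurable F)
    (hFi : Integrable (fun ω => F (w (X ω), Y ω)) P) :
    P[fun ω => F (w (X ω), Y ω) | mβ.comap X] =ᵐ[P]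
      fun ω => ∫ z, F (w (X ω), z) ∂(Q (w (X ω))) := by
  -- Tested on rectangles, the hypothesis identifies the joint law of `X` and `Y`; uniqueness of
  -- disintegration then gives the conditional distribution.
  have hκ : P.map (fun ω => (X ω, Y ω)) = P.map X ⊗ₘ Q.comap w hw := by
    have := Measure.isProbabilityMeasure_map (μ := P) (hX.prodMk hY).aemeasurable
    refine Measure.ext_prod fun {s t} hs ht => ?_
    rw [Measure.map_apply (hX.prodMk hY) (hs.prod ht), Measure.compProd_apply_prod hs ht,
      setLIntegral_map hs (Kernel.measurable_coe _ ht) hX]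
    have hind : Integrable ((Y ⁻¹' t).indicator fun _ => (1 : ℝ)) P :=
      (integrable_const _).indicator (hY ht)
    have h1 := setIntegral_condExp hX.comap_le hind ⟨s, hs, rfl⟩
    rw [integral_indicator (hY ht), Measure.restrict_restrict (hY ht), integral_const,
      setIntegral_congr_ae (hX hs) ((hprob t ht).mono fun ω hω _ => hω)] at h1
    have hint : Integrable (fun ω => (Q (w (X ω))).real t) P :=
      integrable_condExp.congr (hprob t ht)
    have h2 := congrArg ENNReal.ofReal h1
    rw [ofReal_integral_eq_lintegral_ofReal hint.integrableOn
      (ae_of_all _ fun _ => measureReal_nonneg)] at h2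
    simp only [measureReal_def, ENNReal.ofReal_toReal (measure_ne_top _ _), smul_eq_mul, mul_one,
      Measure.restrict_apply_univ] at h2
    rw [Set.mk_preimage_prod, Set.inter_comm, ← h2]
    rfl
  have hcd := ae_of_ae_map hX.aemeasurable
    (condDistrib_ae_eq_of_measure_eq_compProd X hY.aemeasurable hκ)
  have hF' : StronglyMeasurable fun p : β × S => F (w p.1, p.2) :=
    hF.comp_measurable ((hw.comp measurable_fst).prodMk measurable_snd)
  refine (condExp_prod_ae_eq_integral_condDistrib hX hY.aemeasurable hF' hFi).trans ?_
  filter_upwards [hcd] with ω hω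
  rw [hω, Kernel.comap_apply]

namespace IsStationaryChain

lemma comap_le_past {Ω : Type*} (W : ℤ → Ω → S) {k n : ℤ} (hkn : k ≤ n) :
    mS.comap (W k) ≤ past W n :=
  le_iSup (fun k : Set.Iic n => mS.comap (W k)) ⟨k, hkn⟩

lemma past_mono {Ω : Type*} (W : ℤ → Ω → S) : Monotone (past W) := fun _ _ hab =>
  iSup_le fun k => comap_le_past W (le_trans k.2 hab)

lemma measurable_past {Ω : Type*} (W : ℤ → Ω → S) {k n : ℤ} (hkn : k ≤ n) :
    Measurable[past W n] (W k) :=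
  Measurable.of_comap_le (comap_le_past W hkn)

lemma past_le {P : Measure Ω} {Q : Kernel S S} (hW : IsStationaryChain P W Q π) (n : ℤ) :
    past W n ≤ mΩ :=
  iSup_le fun k => (hW.measurable k).comap_le

lemma measurePreserving {P : Measure Ω} {Q : Kernel S S} (hW : IsStationaryChain P W Q π) (n : ℤ) :
    MeasurePreserving (W n) P π := ⟨hW.measurable n, hW.map_eq n⟩

lemma isProbabilityMeasure {Q : Kernel S S} (hW : IsStationaryChain P W Q π) :
    IsProbabilityMeasure π := by
  rw [← hW.map_eq 0]
  exact Measure.isProbabilityMeasure_map (hW.measurable 0).aemeasurable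

lemma comp_ae_eq {P : Measure Ω} {Q : Kernel S S} (hW : IsStationaryChain P W Q π) {f h : S → ℝ}
    (hfh : f =ᵐ[π] h) (n : ℤ) : (fun ω => f (W n ω)) =ᵐ[P] fun ω => h (W n ω) :=
  (hW.measurePreserving n).quasiMeasurePreserving.ae_eq_comp hfh

/-- The filtration generated by the chain, from time zero on. -/
def pastFiltration {P : Measure Ω} {Q : Kernel S S} (hW : IsStationaryChain P W Q π) :
    Filtration ℕ mΩ where
  seq k := past W k
  mono' _ _ hab := past_mono W (by exact_mod_cast hab)
  le' k := hW.past_le k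

/-- Evaluation along the chain, as an isometry of `L²` spaces. -/
noncomputable def eval {P : Measure Ω} {Q : Kernel S S} (hW : IsStationaryChain P W Q π) (n : ℤ) :
    Lp ℝ 2 π →ₗᵢ[ℝ] Lp ℝ 2 P :=
  Lp.compMeasurePreservingₗᵢ ℝ (W n) (hW.measurePreserving n)

lemma coeFn_eval {P : Measure Ω} {Q : Kernel S S} (hW : IsStationaryChain P W Q π) (n : ℤ)
    (x : Lp ℝ 2 π) : (fun ω => x (W n ω)) =ᵐ[P] hW.eval n x :=
  (Lp.coeFn_compMeasurePreserving x (hW.measurePreserving n)).symm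

lemma memLp_comp {P : Measure Ω} {Q : Kernel S S} (hW : IsStationaryChain P W Q π) (n : ℤ)
    (x : Lp ℝ 2 π) : MemLp (fun ω => x (W n ω)) 2 P :=
  (Lp.memLp x).comp_measurePreserving (hW.measurePreserving n)

lemma condExp_pair [StandardBorelSpace S] [Nonempty S]
    (hW : IsStationaryChain P W Q π) (n : ℤ) {F : S × S → ℝ}
    (hF : StronglyMeasurable F) (hFi : Integrable (fun ω => F (W n ω, W (n + 1) ω)) P) :
    P[fun ω => F (W n ω, W (n + 1) ω) | past W n] =ᵐ[P]
      fun ω => ∫ z, F (W n ω, z) ∂(Q (W n ω)) := by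
  -- Here `X` is the identity from `Ω` to `Ω` carrying the smaller `σ`-algebra `past W n`, so
  -- conditioning on `X` is conditioning on the past.
  have h := @condExp_eq_integral_of_condProb Ω S mΩ mS P _ Q _ _ _ Ω (past W n) id
    (measurable_id'' (hW.past_le n)) (W n) (measurable_past W le_rfl) (W (n + 1))
    (hW.measurable (n + 1)) (by rw [MeasurableSpace.comap_id]; exact hW.markov n) F hF hFi
  rwa [MeasurableSpace.comap_id] at h

/-- The limit hypotheses condition on `W_{k-1}` alone and the martingale theorem on the whole past.
By the Markov property the latter conditional expectation is a function of `W n`, so the two agree.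
-/
lemma condExp_comap_pair [StandardBorelSpace S] [Nonempty S]
    (hW : IsStationaryChain P W Q π) (n : ℤ) {F : S × S → ℝ}
    (hF : StronglyMeasurable F) (hFi : Integrable (fun ω => F (W n ω, W (n + 1) ω)) P) :
    P[fun ω => F (W n ω, W (n + 1) ω) | mS.comap (W n)] =ᵐ[P]
      P[fun ω => F (W n ω, W (n + 1) ω) | past W n] := by
  have h := hW.condExp_pair n hF hFi
  have hint : Integrable (fun ω => ∫ z, F (W n ω, z) ∂(Q (W n ω))) P := integrable_condExp.congr h
  have hsm : StronglyMeasurable[mS.comap (W n)] fun ω => ∫ z, F (W n ω, z) ∂(Q (W n ω)) :=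
    (hF.integral_kernel_prod_right' (κ := Q)).comp_measurable (comap_measurable (W n))
  refine (condExp_condExp_of_le (comap_le_past W le_rfl) (hW.past_le n)).symm.trans ?_
  refine (condExp_congr_ae h).trans ?_
  rw [condExp_of_stronglyMeasurable (hW.measurable n).comap_le hsm hint]
  exact h.symm

lemma condExp_next [StandardBorelSpace S] [Nonempty S]
    (hW : IsStationaryChain P W Q π) [IsFiniteMeasure π] (hinv : Q.Invariant π)
    (n : ℤ) (x : Lp ℝ 2 π) :
    P[fun ω => x (W (n + 1) ω) | past W n] =ᵐ[P] fun ω => transLp hinv x (W n ω) :=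
  (hW.condExp_pair n (F := fun p => x p.2)
    ((Lp.stronglyMeasurable x).comp_measurable measurable_snd)
    ((hW.memLp_comp (n + 1) x).integrable (by norm_num))).trans
    (hW.comp_ae_eq (coeFn_transLp hinv (EventuallyEq.refl _ x)) n)

lemma inner_eval_succ [StandardBorelSpace S] [Nonempty S]
    (hW : IsStationaryChain P W Q π) [IsFiniteMeasure π]
    (hinv : Q.Invariant π) {i k : ℤ} (hik : i ≤ k) (x y : Lp ℝ 2 π) :
    inner ℝ (hW.eval i x) (hW.eval (k + 1) y) =
      (inner ℝ (hW.eval i x) (hW.eval k (transLp hinv y)) : ℝ) := by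
  rw [inner_eq_integral_mul (hW.coeFn_eval i x) (hW.coeFn_eval (k + 1) y),
    inner_eq_integral_mul (hW.coeFn_eval i x) (hW.coeFn_eval k _),
    ← integral_condExp (hW.past_le k)]
  have hx : StronglyMeasurable[past W k] fun ω => x (W i ω) :=
    (Lp.stronglyMeasurable x).comp_measurable (measurable_past W hik)
  refine integral_congr_ae ((condExp_mul_of_stronglyMeasurable_left hx
    ((hW.memLp_comp i x).integrable_mul (hW.memLp_comp (k + 1) y))
    ((hW.memLp_comp (k + 1) y).integrable (by norm_num))).trans ?_)
  filter_upwards [hW.condExp_next hinv k y] with ω hω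
  rw [Pi.mul_apply, hω]

lemma inner_eval_add [StandardBorelSpace S] [Nonempty S]
    (hW : IsStationaryChain P W Q π) [IsFiniteMeasure π]
    (hinv : Q.Invariant π) (i m : ℕ) (x y : Lp ℝ 2 π) :
    inner ℝ (hW.eval i x) (hW.eval ((i + m : ℕ) : ℤ) y) =
      (inner ℝ x ((transLp hinv ^ m) y) : ℝ) := by
  induction m generalizing y with
  | zero => simp
  | succ m ih =>
    rw [show ((i + (m + 1) : ℕ) : ℤ) = ((i + m : ℕ) : ℤ) + 1 by push_cast; ring,
      hW.inner_eval_succ hinv (by push_cast; omega), ih, ← Module.End.mul_apply, ← pow_succ]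

/-- The conditional variance is taken as an explicit kernel integral, so that it is predictable and
nonnegative everywhere and not just almost everywhere. -/
lemma isMartingaleDiff [StandardBorelSpace S] [Nonempty S]
    (hW : IsStationaryChain P W Q π) [IsFiniteMeasure π]
    (hinv : Q.Invariant π) (y : Lp ℝ 2 π) (r : ℝ) :
    IsMartingaleDiff P hW.pastFiltration
      (fun k ω => r * (y (W ((k : ℤ) + 1) ω) - transLp hinv y (W k ω)))
      (fun k ω => ∫ z, (r * (y z - transLp hinv y (W k ω))) ^ 2 ∂(Q (W k ω))) := by
  have hy := (Lp.stronglyMeasurable y).measurable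
  have hq := (Lp.stronglyMeasurable (transLp hinv y)).measurable
  have hF : StronglyMeasurable fun p : S × S => (r * (y p.2 - transLp hinv y p.1)) ^ 2 :=
    Measurable.stronglyMeasurable (by fun_prop)
  have hmem : ∀ k : ℕ,
      MemLp (fun ω => r * (y (W ((k : ℤ) + 1) ω) - transLp hinv y (W k ω))) 2 P := fun k =>
    ((hW.memLp_comp _ y).sub (hW.memLp_comp _ _)).const_mul r
  refine ⟨fun k => ?_, hmem, fun k => ?_, fun k => ?_, fun k ω => ?_, fun k => ?_⟩
  · have h1 : Measurable[past W ((k + 1 : ℕ) : ℤ)] (W ((k : ℤ) + 1)) :=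
      measurable_past W (by push_cast; exact le_rfl)
    have h2 : Measurable[past W ((k + 1 : ℕ) : ℤ)] (W k) := measurable_past W (by push_cast; omega)
    exact Measurable.stronglyMeasurable ((((hy.comp h1).sub (hq.comp h2))).const_mul r)
  · have h1 : StronglyMeasurable[past W k] fun ω => transLp hinv y (W k ω) :=
      (Lp.stronglyMeasurable _).comp_measurable (measurable_past W le_rfl)
    have hi1 := (hW.memLp_comp ((k : ℤ) + 1) y).integrable (by norm_num : (1 : ℝ≥0∞) ≤ 2)
    have hi2 := (hW.memLp_comp k (transLp hinv y)).integrable (by norm_num : (1 : ℝ≥0∞) ≤ 2)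
    refine (condExp_smul r (fun ω => y (W ((k : ℤ) + 1) ω) - transLp hinv y (W k ω)) _).trans ?_
    filter_upwards [condExp_sub hi1 hi2 (past W k), hW.condExp_next hinv k y] with ω h2 h3
    have h4 : (P[fun ω => y (W ((k : ℤ) + 1) ω) - transLp hinv y (W k ω) | past W k]) ω = 0 := by
      refine h2.trans ?_
      rw [Pi.sub_apply, h3, condExp_of_stronglyMeasurable (hW.past_le k) h1 hi2, sub_self]
    show r • _ = (0 : ℝ)
    rw [smul_eq_mul, mul_eq_zero]
    exact Or.inr h4
  · exact (hF.integral_kernel_prod_right' (κ := Q)).comp_measurable (measurable_past W le_rfl)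
  · exact integral_nonneg fun z => sq_nonneg _
  · exact hW.condExp_pair k hF (hmem k).integrable_sq

end IsStationaryChain

end Markov

/-! ### Consequences of slow variation. -/

lemma sum_Icc_one_eq_sum_range {M : Type*} [AddCommMonoid M] (F : ℕ → M) (n : ℕ) :
    ∑ k ∈ Finset.Icc 1 n, F k = ∑ k ∈ Finset.range n, F (k + 1) := by
  induction n with
  | zero => simp
  | succ n ih => rw [Finset.sum_Icc_succ_top (by omega), ih, Finset.sum_range_succ]

lemma IsSlowlyVarying.tendsto_doubling {ℓ : ℝ → ℝ} (hℓ : IsSlowlyVarying ℓ) {σ : ℕ → ℝ}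
    (hσ : ∀ n : ℕ, 0 < n → σ n ^ 2 = n * ℓ n) :
    Tendsto (fun n => σ (2 * n) ^ 2 / σ n ^ 2) atTop (𝓝 2) := by
  have h := ((hℓ.2 2 two_pos).comp (tendsto_natCast_atTop_atTop (R := ℝ))).const_mul 2
  rw [mul_one] at h
  refine h.congr' ?_
  filter_upwards [eventually_gt_atTop 0] with n hn
  have hn' : (n : ℝ) ≠ 0 := by exact_mod_cast hn.ne'
  rw [hσ _ hn, hσ (2 * n) (by omega)]
  push_cast
  rw [Function.comp_apply, mul_comm (2 : ℝ) n, mul_assoc (n : ℝ) 2, mul_div_mul_left _ _ hn',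
    mul_comm (n : ℝ) 2, mul_div_assoc]

lemma IsSlowlyVarying.eventually_pos {ℓ : ℝ → ℝ} (hℓ : IsSlowlyVarying ℓ) {σ : ℕ → ℝ}
    (hσ : ∀ n : ℕ, 0 < n → σ n ^ 2 = n * ℓ n) (h0 : ∀ n, 0 ≤ σ n) : ∀ᶠ n in atTop, 0 < σ n := by
  obtain ⟨⟨X, hX, -⟩, -⟩ := hℓ
  filter_upwards [eventually_gt_atTop 0,
    (tendsto_natCast_atTop_atTop (R := ℝ)).eventually_ge_atTop X] with n hn hnX
  have hn' : (0 : ℝ) < n := by exact_mod_cast hn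
  have h1 : 0 < σ n ^ 2 := by rw [hσ n hn]; exact mul_pos hn' (hX _ hnX)
  exact lt_of_le_of_ne (h0 n) fun h => by simp [← h] at h1

/-! ### Negligibility of the martingale approximation error. -/

section Main

variable {Ω S : Type*} [mΩ : MeasurableSpace Ω] [mS : MeasurableSpace S] {P : Measure Ω} [IsProbabilityMeasure P] {W : ℤ → Ω → S} {Q : Kernel S S}
  [IsMarkovKernel Q] {π : Measure S}

lemma IsStationaryChain.partialSum_ae_eq {P : Measure Ω} {Q : Kernel S S}
    (hW : IsStationaryChain P W Q π) {g : S → ℝ}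
    {x : Lp ℝ 2 π} (hgx : g =ᵐ[π] x) (n : ℕ) :
    partialSum g W n =ᵐ[P]
      (∑ k ∈ Finset.range n, hW.eval ((k + 1 : ℕ) : ℤ) x : Lp ℝ 2 P) := by
  have h := coeFn_finsetSum_of_ae_eq (Finset.range n) (f := fun k ω => g (W ((k + 1 : ℕ) : ℤ) ω))
    fun k _ => (hW.comp_ae_eq hgx ((k + 1 : ℕ) : ℤ)).trans (hW.coeFn_eval _ x)
  refine EventuallyEq.trans (ae_of_all _ fun ω => ?_) h
  exact sum_Icc_one_eq_sum_range (fun k => g (W (k : ℤ) ω)) n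

lemma integral_sq_eq_norm_sq {α : Type*} [MeasurableSpace α] {μ : Measure α} {f : α → ℝ}
    {x : Lp ℝ 2 μ} (h : f =ᵐ[μ] x) : ∫ a, f a ^ 2 ∂μ = ‖x‖ ^ 2 := by
  rw [← real_inner_self_eq_norm_sq, inner_eq_integral_mul h h]
  simp_rw [sq]

lemma IsStationaryChain.sigma_eq_norm {P : Measure Ω} {Q : Kernel S S}
    (hW : IsStationaryChain P W Q π) {g : S → ℝ}
    {x : Lp ℝ 2 π} (hgx : g =ᵐ[π] x) (n : ℕ) :
    sigma P g W n = ‖∑ k ∈ Finset.range n, hW.eval ((k + 1 : ℕ) : ℤ) x‖ := by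
  rw [sigma, integral_sq_eq_norm_sq (hW.partialSum_ae_eq hgx n), Real.sqrt_sq (norm_nonneg _)]

/-- The partial sums of a reversible chain with slowly varying normalized variances are within
`o(σ_n)` of a martingale. -/
lemma IsStationaryChain.eventually_norm_sum_sub_martingale_le [StandardBorelSpace S] [Nonempty S]
    [IsFiniteMeasure π]
    (hW : IsStationaryChain P W Q π) (hrev : Q.IsReversible π) {g : S → ℝ} {x : Lp ℝ 2 π}
    (hgx : g =ᵐ[π] x) {ℓ : ℝ → ℝ} (hℓ : IsSlowlyVarying ℓ)
    (hσ : ∀ n : ℕ, 0 < n → sigma P g W n ^ 2 = n * ℓ n) {κ : ℝ} (hκ : 0 < κ) :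
    ∀ᶠ n : ℕ in atTop, ‖∑ k ∈ Finset.range n, hW.eval ((k + 1 : ℕ) : ℤ) x -
      ∑ k ∈ Finset.range n, (hW.eval ((k + 1 : ℕ) : ℤ) (powSumAvg (transLp hrev.invariant) x n) -
        hW.eval k (transLp hrev.invariant (powSumAvg (transLp hrev.invariant) x n)))‖ ≤
      κ * sigma P g W n := by
  set T := transLp hrev.invariant with hT
  have hsymm : T.IsSymmetric := isSymmetric_transLp hrev
  have hc : ∀ x, ‖T x‖ ≤ ‖x‖ := norm_transLp_le hrev.invariant
  set J : ℕ → Lp ℝ 2 π →ₗᵢ[ℝ] Lp ℝ 2 P := fun k => hW.eval k with hJ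
  have hσn : ∀ n, sigma P g W n = ‖∑ k ∈ Finset.range n, J (k + 1) x‖ := hW.sigma_eq_norm hgx
  have hσv : ∀ n, sigma P g W n ^ 2 = varSeq (fun k => inner ℝ x ((T ^ k) x)) n := fun n => by
    rw [hσn]
    exact norm_sum_sq_eq_varSeq J x (fun i m => hW.inner_eval_add hrev.invariant i m x x) n
  have h0 : ∀ n, 0 ≤ sigma P g W n := fun n => Real.sqrt_nonneg _
  have hle : ∀ j n, j ≤ n → sigma P g W j ≤ sigma P g W n + 2 * ‖x‖ := fun j n hjn => by
    refine le_add_of_odd_mono h0 ?_ (norm_nonneg x) (fun n => ?_) ?_ hjn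
    · simp_rw [hσv]; exact varSeq_odd_mono hsymm x
    · rw [hσn, hσn, Finset.sum_range_succ]
      refine (abs_norm_sub_norm_le _ _).trans ?_
      rw [add_sub_cancel_left, LinearIsometry.norm_map]
    · rw [hσn]; simp
  -- The approximation error is three times a bound on `‖V_j x‖` for `j ≤ n`, so each is required to
  -- be at most `(κ / 3) σ_n`.
  filter_upwards [eventually_forall_le_mul_sq hle h0 (hℓ.eventually_pos hσ h0)
    (hℓ.tendsto_doubling hσ) (v := fun n => ‖powSum T x n‖ ^ 2) (K := 4 * ‖x‖ ^ 2)
    (fun n => by rw [hσv, hσv]; exact norm_powSum_sq_le hsymm hc x n)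
    (by positivity : 0 < (κ / 3) ^ 2)] with n hn
  refine (norm_sum_sub_martingale_le hc J x n (B := κ / 3 * sigma P g W n) fun j hj => ?_).trans
    (by linarith)
  have h1 := hn j hj
  rw [← mul_pow] at h1
  have := h0 n
  exact (sq_le_sq₀ (norm_nonneg _) (by positivity)).1 h1

lemma norm_exp_mul_I_sub_le (a b : ℝ) :
    ‖Complex.exp (a * Complex.I) - Complex.exp (b * Complex.I)‖ ≤ |a - b| := by
  have e : Complex.exp (a * Complex.I) - Complex.exp (b * Complex.I) =
      Complex.exp (b * Complex.I) * (Complex.exp (Complex.I * (a - b : ℝ)) - 1) := by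
    rw [mul_sub, mul_one, ← Complex.exp_add]
    push_cast
    congr 2
    ring
  rw [e, norm_mul, Complex.norm_exp_ofReal_mul_I, one_mul]
  exact Real.norm_exp_I_mul_ofReal_sub_one_le

/-- The inequality `|a| ≤ κ + κ⁻¹ a²` converts the mean square bound into a bound in mean. -/
lemma norm_integral_mul_exp_sub_exp_le_of_sq {X : Ω → ℂ} (hX : ∀ ω, ‖X ω‖ ≤ 1) {A B : Ω → ℝ}
    (hA : MemLp A 2 P) (hB : MemLp B 2 P) (t : ℝ) {κ : ℝ} (hκ : 0 < κ)
    (h : ∫ ω, (A ω - B ω) ^ 2 ∂P ≤ κ ^ 2) :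
    ‖∫ ω, X ω * (Complex.exp ((t * A ω : ℝ) * Complex.I)
      - Complex.exp ((t * B ω : ℝ) * Complex.I)) ∂P‖ ≤ |t| * (2 * κ) := by
  have hsq := (hA.sub hB).integrable_sq
  simp only [Pi.sub_apply] at hsq
  have hpt : ∀ ω, ‖X ω * (Complex.exp ((t * A ω : ℝ) * Complex.I)
      - Complex.exp ((t * B ω : ℝ) * Complex.I))‖ ≤ |t| * (κ + κ⁻¹ * (A ω - B ω) ^ 2) := fun ω => by
    rw [norm_mul]
    refine (mul_le_of_le_one_left (norm_nonneg _) (hX ω)).trans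
      ((norm_exp_mul_I_sub_le _ _).trans ?_)
    rw [← mul_sub, abs_mul]
    gcongr
    rw [← sq_abs (A ω - B ω), ← sub_nonneg]
    have : κ + κ⁻¹ * |A ω - B ω| ^ 2 - |A ω - B ω| =
        κ⁻¹ * ((|A ω - B ω| - κ / 2) ^ 2 + 3 / 4 * κ ^ 2) := by
      field_simp; ring
    rw [this]
    positivity
  refine (norm_integral_le_of_norm_le
    (((integrable_const κ).add (hsq.const_mul κ⁻¹)).const_mul |t|) (ae_of_all _ hpt)).trans ?_
  simp only [Pi.add_apply]
  rw [integral_const_mul, integral_add (integrable_const κ) (hsq.const_mul κ⁻¹),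
    integral_const_mul, integral_const, probReal_univ, one_smul]
  gcongr
  have : κ⁻¹ * ∫ ω, (A ω - B ω) ^ 2 ∂P ≤ κ⁻¹ * κ ^ 2 := by gcongr
  have e : κ⁻¹ * κ ^ 2 = κ := by field_simp
  linarith

end Main

end RevChain

/-! ### Assembly of the limit theorem. -/

theorem corollary2p2
    {Ω S : Type*} [MeasurableSpace Ω]
    [TopologicalSpace S] [PolishSpace S] [mS : MeasurableSpace S] [BorelSpace S]
    (P : Measure Ω) [IsProbabilityMeasure P]
    (π : Measure S) (Q : Kernel S S) [IsMarkovKernel Q]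
    (W : ℤ → Ω → S) (hW : RevChain.IsStationaryChain P W Q π)
    (hrev : Q.IsReversible π)
    (g : S → ℝ) (hg : MemLp g 2 π) (hg0 : ∫ w, g w ∂π = 0)
    (ℓ : ℝ → ℝ) (hℓ : RevChain.IsSlowlyVarying ℓ)
    (hσ : ∀ n : ℕ, 0 < n → RevChain.sigma P g W n ^ 2 = n * ℓ n)
    (v : ℝ≥0)
    (hvar : TendstoInMeasure P
      (fun (n : ℕ) ω => (RevChain.sigma P g W n ^ 2)⁻¹ *
        ∑ k ∈ Finset.Icc 1 n,
          (P[fun ω' => RevChain.D Q g W n (k : ℤ) ω' ^ 2 | mS.comap (W ((k : ℤ) - 1))]) ω)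
      atTop (fun _ => (v : ℝ)))
    (hlind : ∀ ε : ℝ, 0 < ε → TendstoInMeasure P
      (fun (n : ℕ) ω => (RevChain.sigma P g W n ^ 2)⁻¹ *
        ∑ k ∈ Finset.Icc 1 n,
          (P[{ω' | ε * RevChain.sigma P g W n < |RevChain.D Q g W n (k : ℤ) ω'|}.indicator
              (fun ω' => RevChain.D Q g W n (k : ℤ) ω' ^ 2) | mS.comap (W ((k : ℤ) - 1))]) ω)
      atTop (fun _ => (0 : ℝ))) :
    RevChain.TendstoCondLaw P
      (fun n ω => RevChain.partialSum g W n ω / RevChain.sigma P g W n) (W 0)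
      ⟨gaussianReal 0 v, inferInstance⟩ := by
  have : Nonempty Ω := nonempty_of_isProbabilityMeasure P
  have : Nonempty S := Nonempty.map (W 0) this
  have : IsProbabilityMeasure π := hW.isProbabilityMeasure
  have hinv := hrev.invariant
  set T := RevChain.transLp hinv with hT
  set x : Lp ℝ 2 π := hg.toLp g with hx
  have hgx : g =ᵐ[π] x := hg.coeFn_toLp.symm
  set σ : ℕ → ℝ := RevChain.sigma P g W with hσdef
  have hσ0 : ∀ n, 0 ≤ σ n := fun n => Real.sqrt_nonneg _
  set y : ℕ → Lp ℝ 2 π := RevChain.powSumAvg T x with hy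
  -- Up to a null set this is `D_{n,k+1} / σ_n`, in terms of `L²` representatives; the index is
  -- shifted so that conditioning is on `ℱ k`.
  set ξ : ℕ → ℕ → Ω → ℝ := fun n k ω =>
    (σ n)⁻¹ * (y n (W ((k : ℤ) + 1) ω) - T (y n) (W k ω)) with hξ
  set s : ℕ → ℕ → Ω → ℝ := fun n k ω =>
    ∫ z, ((σ n)⁻¹ * (y n z - T (y n) (W k ω))) ^ 2 ∂(Q (W k ω)) with hs
  have hmd : ∀ n, RevChain.IsMartingaleDiff P hW.pastFiltration (ξ n) (s n) := fun n =>
    hW.isMartingaleDiff hinv (y n) (σ n)⁻¹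
  have hD : ∀ n k : ℕ, (fun ω => (σ n)⁻¹ * RevChain.D Q g W n ((k + 1 : ℕ) : ℤ) ω) =ᵐ[P] ξ n k :=
    fun n k => by
      have h1 := RevChain.coeFn_Vbar hinv hgx n
      filter_upwards [hW.comp_ae_eq h1 ((k : ℤ) + 1),
        hW.comp_ae_eq (RevChain.coeFn_transLp hinv h1) k] with ω h2 h3
      simp only [RevChain.D, hξ, Nat.cast_succ, add_sub_cancel_right]
      rw [h2, h3]
  have hyq : ∀ n, Measurable fun p : S × S => (σ n)⁻¹ * (y n p.2 - T (y n) p.1) := fun n => by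
    have h1 := (Lp.stronglyMeasurable (y n)).measurable
    have h2 := (Lp.stronglyMeasurable (T (y n))).measurable
    fun_prop
  have hvar' : TendstoInMeasure P (fun (n : ℕ) ω => ∑ k ∈ Finset.range n, s n k ω) atTop
      (fun _ => (v : ℝ)) := by
    refine hvar.congr_left fun n => ?_
    have hk : ∀ k : ℕ, (fun ω => (σ n ^ 2)⁻¹ * (P[fun ω' => RevChain.D Q g W n ((k + 1 : ℕ) : ℤ) ω' ^ 2
        | mS.comap (W (((k + 1 : ℕ) : ℤ) - 1))]) ω) =ᵐ[P] s n k := fun k => by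
      have h1 := hW.condExp_comap_pair k ((hyq n).pow_const 2).stronglyMeasurable
        ((hmd n).memLp k).integrable_sq
      rw [show ((k + 1 : ℕ) : ℤ) - 1 = k by push_cast; ring]
      refine ((condExp_smul (σ n ^ 2)⁻¹ _ _).symm.trans (condExp_congr_ae ?_)).trans
        (h1.trans ((hmd n).condVar k))
      filter_upwards [hD n k] with ω hω
      simp only [Pi.smul_apply, smul_eq_mul]
      rw [← inv_pow, ← mul_pow, hω]
    filter_upwards [ae_all_iff.2 hk] with ω hω
    rw [RevChain.sum_Icc_one_eq_sum_range (fun k : ℕ =>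
      (P[fun ω' => RevChain.D Q g W n (k : ℤ) ω' ^ 2 | mS.comap (W ((k : ℤ) - 1))]) ω),
      Finset.mul_sum]
    exact Finset.sum_congr rfl fun k _ => hω k
  have hlind' : ∀ ε : ℝ, 0 < ε → TendstoInMeasure P (fun n ω => ∑ k ∈ Finset.range n,
      (P[{ω' | ε < |ξ n k ω'|}.indicator (fun ω' => ξ n k ω' ^ 2) | hW.pastFiltration k]) ω)
      atTop (fun _ => 0) := fun ε hε => by
    refine (hlind ε hε).congr_left fun n => ?_
    have hk : ∀ k : ℕ, (fun ω => (σ n ^ 2)⁻¹ *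
        (P[{ω' | ε * σ n < |RevChain.D Q g W n ((k + 1 : ℕ) : ℤ) ω'|}.indicator
              (fun ω' => RevChain.D Q g W n ((k + 1 : ℕ) : ℤ) ω' ^ 2)
        | mS.comap (W (((k + 1 : ℕ) : ℤ) - 1))]) ω) =ᵐ[P]
        P[{ω' | ε < |ξ n k ω'|}.indicator (fun ω' => ξ n k ω' ^ 2) | hW.pastFiltration k] :=
      fun k => by
      have hset : MeasurableSet {p : S × S | ε < |(σ n)⁻¹ * (y n p.2 - T (y n) p.1)|} :=
        (hyq n).norm measurableSet_Ioi
      have hsetΩ : MeasurableSet {ω' | ε < |ξ n k ω'|} :=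
        hset.preimage ((hW.measurable k).prodMk (hW.measurable ((k : ℤ) + 1)))
      have h1 := hW.condExp_comap_pair k (((hyq n).pow_const 2).indicator hset).stronglyMeasurable
        (((hmd n).memLp k).integrable_sq.indicator hsetΩ)
      rw [show ((k + 1 : ℕ) : ℤ) - 1 = k by push_cast; ring]
      refine ((condExp_smul (σ n ^ 2)⁻¹ _ _).symm.trans (condExp_congr_ae ?_)).trans h1
      filter_upwards [hD n k] with ω hω
      have hω' : (σ n)⁻¹ * (y n (W ((k : ℤ) + 1) ω) - T (y n) (W k ω)) =
        (σ n)⁻¹ * RevChain.D Q g W n ((k + 1 : ℕ) : ℤ) ω := hω.symm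
      simp only [Pi.smul_apply, smul_eq_mul, Set.indicator, Set.mem_ofPred_eq, hω']
      rcases (hσ0 n).eq_or_lt with h0 | h0
      -- If `σ n = 0` its inverse is `0`, and both sides vanish.
      · simp [← h0]
      · have hiff : ∀ d : ℝ, ε < |(σ n)⁻¹ * d| ↔ ε * σ n < |d| := fun d => by
          rw [abs_mul, abs_of_pos (inv_pos.2 h0), lt_inv_mul_iff₀ h0, mul_comm (σ n) ε]
        simp only [hiff]
        split_ifs
        · rw [mul_pow, inv_pow]
        · simp
    filter_upwards [ae_all_iff.2 hk] with ω hω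
    rw [RevChain.sum_Icc_one_eq_sum_range (fun k : ℕ =>
      (P[{ω' | ε * σ n < |RevChain.D Q g W n (k : ℤ) ω'|}.indicator
              (fun ω' => RevChain.D Q g W n (k : ℤ) ω' ^ 2) | mS.comap (W ((k : ℤ) - 1))]) ω),
      Finset.mul_sum]
    exact Finset.sum_congr rfl fun k _ => hω k
  have hSmem : ∀ n, MemLp (RevChain.partialSum g W n) 2 P := fun n =>
    (memLp_congr_ae (hW.partialSum_ae_eq hgx n)).2 (Lp.memLp _)
  have hZmem : ∀ n, MemLp (fun ω => RevChain.partialSum g W n ω / σ n) 2 P := fun n => by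
    simp_rw [div_eq_inv_mul]
    exact (hSmem n).const_mul _
  have hσsq : ∀ n, ∫ ω, RevChain.partialSum g W n ω ^ 2 ∂P = σ n ^ 2 := fun n =>
    (Real.sq_sqrt (integral_nonneg fun ω => sq_nonneg _)).symm
  refine RevChain.tendstoCondLaw_of_charFun hZmem (hW.measurable 0) (C := 1) (fun n => ?_) _
    fun t η hη => ?_
  · simp_rw [div_pow]
    rw [integral_div, hσsq]
    exact div_self_le_one _
  -- Half of `η` pays for replacing `S_n / σ_n` by the martingale, at cost `2 κ |t|`; the other half
  -- is for the central limit theorem.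
  set κ : ℝ := η / (4 * (|t| + 1)) with hκ
  have hκ0 : 0 < κ := by positivity
  have hκt : |t| * (2 * κ) ≤ η / 2 := by
    have : (|t| + 1) * (2 * κ) = η / 2 := by rw [hκ]; field_simp; ring
    nlinarith
  filter_upwards [RevChain.IsMartingaleDiff.eventually_norm_integral_le hmd v.2 hvar' hlind' t
      (half_pos hη),
    hW.eventually_norm_sum_sub_martingale_le hrev hgx hℓ hσ hκ0,
    hℓ.eventually_pos hσ hσ0] with n hn1 hn2 hn3 X hX hX1
  set M : Ω → ℝ := fun ω => ∑ k ∈ Finset.range n, ξ n k ω with hM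
  have hMmem : MemLp M 2 P := memLp_finsetSum _ fun k _ => (hmd n).memLp k
  have hclose : ∫ ω, (RevChain.partialSum g W n ω / σ n - M ω) ^ 2 ∂P ≤ κ ^ 2 := by
    set R : Lp ℝ 2 P := ∑ k ∈ Finset.range n, hW.eval ((k + 1 : ℕ) : ℤ) x -
      ∑ k ∈ Finset.range n, (hW.eval ((k + 1 : ℕ) : ℤ) (y n) - hW.eval k (T (y n))) with hR
    have h1 : (fun ω => RevChain.partialSum g W n ω -
        ∑ k ∈ Finset.range n, (y n (W ((k : ℤ) + 1) ω) - T (y n) (W k ω))) =ᵐ[P] R := by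
      have h2 := RevChain.coeFn_finsetSum_of_ae_eq (Finset.range n)
        (f := fun k ω => y n (W ((k : ℤ) + 1) ω) - T (y n) (W k ω))
        (x := fun k => hW.eval ((k + 1 : ℕ) : ℤ) (y n) - hW.eval k (T (y n))) fun k _ => by
          filter_upwards [hW.coeFn_eval ((k + 1 : ℕ) : ℤ) (y n), hW.coeFn_eval k (T (y n)),
            Lp.coeFn_sub (hW.eval ((k + 1 : ℕ) : ℤ) (y n)) (hW.eval k (T (y n)))] with ω h3 h4 h5
          rw [h5, Pi.sub_apply, ← h3, ← h4, Nat.cast_succ]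
      filter_upwards [hW.partialSum_ae_eq hgx n, h2, Lp.coeFn_sub
        (∑ k ∈ Finset.range n, hW.eval ((k + 1 : ℕ) : ℤ) x)
        (∑ k ∈ Finset.range n, (hW.eval ((k + 1 : ℕ) : ℤ) (y n) - hW.eval k (T (y n))))]
        with ω h3 h4 h5
      rw [hR, h5, Pi.sub_apply, h3, h4]
    have h2 : ∀ ω, (RevChain.partialSum g W n ω / σ n - M ω) ^ 2 = (σ n ^ 2)⁻¹ *
        (RevChain.partialSum g W n ω -
          ∑ k ∈ Finset.range n, (y n (W ((k : ℤ) + 1) ω) - T (y n) (W k ω))) ^ 2 := fun ω => by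
      simp only [hM, hξ]
      rw [← Finset.mul_sum, div_eq_inv_mul, ← mul_sub, mul_pow, inv_pow]
    simp_rw [h2]
    rw [integral_const_mul, RevChain.integral_sq_eq_norm_sq h1, inv_mul_le_iff₀ (by positivity),
      ← mul_pow, mul_comm (σ n)]
    exact pow_le_pow_left₀ (norm_nonneg _) hn2 2
  -- The initial `σ`-algebra is the whole past up to time `0`, so test functions of `W 0` are among
  -- those allowed.
  have hX0 : StronglyMeasurable[hW.pastFiltration 0] X :=
    hX.mono (RevChain.IsStationaryChain.comap_le_past W (by simp))
  have h1 := hn1 X hX0 hX1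
  have h2 := RevChain.norm_integral_mul_exp_sub_exp_le_of_sq hX1 (hZmem n) hMmem t hκ0 hclose
  have hchar : charFun (gaussianReal 0 v) t = (Real.exp (-(t ^ 2 * v / 2)) : ℝ) := by
    rw [charFun_gaussianReal]
    push_cast
    congr 1
    ring
  have hXm : AEStronglyMeasurable X P := (hX.mono (hW.measurable 0).comap_le).aestronglyMeasurable
  have hexp : ∀ {A : Ω → ℝ}, MemLp A 2 P →
      Integrable (fun ω => Complex.exp ((t * A ω : ℝ) * Complex.I)) P := fun {A} hA =>
    .of_bound (C := 1) ((by fun_prop : Measurable fun a : ℝ =>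
      Complex.exp ((t * a : ℝ) * Complex.I)).comp_aemeasurable
        hA.1.aemeasurable).aestronglyMeasurable
      (ae_of_all _ fun ω => (Complex.norm_exp_ofReal_mul_I _).le)
  have hi1 : Integrable (fun ω => X ω * (Complex.exp ((t * M ω : ℝ) * Complex.I)
      - Real.exp (-(t ^ 2 * v / 2)))) P :=
    ((hexp hMmem).sub (integrable_const _)).bdd_mul hXm (ae_of_all _ hX1)
  have hi2 : Integrable (fun ω => X ω *
      (Complex.exp ((t * (RevChain.partialSum g W n ω / σ n) : ℝ) * Complex.I)
      - Complex.exp ((t * M ω : ℝ) * Complex.I))) P :=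
    ((hexp (hZmem n)).sub (hexp hMmem)).bdd_mul hXm (ae_of_all _ hX1)
  have hsplit : ∫ ω, X ω * (Complex.exp ((t * (RevChain.partialSum g W n ω / σ n) : ℝ) * Complex.I)
      - charFun (gaussianReal 0 v) t) ∂P =
      ∫ ω, X ω * (Complex.exp ((t * M ω : ℝ) * Complex.I) - Real.exp (-(t ^ 2 * v / 2))) ∂P +
      ∫ ω, X ω * (Complex.exp ((t * (RevChain.partialSum g W n ω / σ n) : ℝ) * Complex.I)
      - Complex.exp ((t * M ω : ℝ) * Complex.I)) ∂P := by
    rw [← integral_add hi1 hi2, hchar]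
    refine integral_congr_ae (ae_of_all _ fun ω => ?_)
    ring
  show ‖∫ ω, X ω * (Complex.exp ((t * (RevChain.partialSum g W n ω / σ n) : ℝ) * Complex.I)
      - charFun (gaussianReal 0 v) t) ∂P‖ ≤ η
  rw [hsplit]
  exact (norm_add_le _ _).trans ((add_le_add h1 (h2.trans hκt)).trans_eq (add_halves η))
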